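/- Let $\rho\colon\mathbb{C}\to\mathbb{C}$ be a quasiconformal mapping, that is, an orientation preserving homeomorphism of the plane which belongs to the Sobolev class $W^{1,2}_{loc}(\mathbb{C})$ and satisfies $\bar\partial\rho=\mu\,\partial\rho$ almost everywhere, in the sense of weak derivatives, for some measurable function $\mu$ with $\|\mu\|_\infty<1$. Assume that $\rho$, extended to the Riemann sphere by $\rho(\infty)=\infty$, is analytic at $\infty$, that is, the map $w\mapsto 1/\rho(1/w)$, $0\mapsto 0$, is analytic in a neighbourhood of $0$. Assume moreover that $$\int_{\mathbb{C}}\frac{|\bar\partial\rho(z)|^2}{|y|}\,dm(z)<\infty,\qquad y=\operatorname{Im}z,$$ where $m$ is Lebesgue measure on the plane. Then the curve $\Gamma=\rho(\mathbb{R})$ is locally rectifiable, that is, $\rho([a,b])$ has finite length for all real $a<b$; and $\rho'|_{\mathbb{R}}\in L^2_{loc}(\mathbb{R})$, that is, the function $x\mapsto\rho(x)$ on $\mathbb{R}$ is absolutely continuous on every compact interval, it is differentiable at almost every $x\in\mathbb{R}$, and its derivative is square integrable on every compact subset of $\mathbb{R}$. -/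

import Mathlib

open MeasureTheory
open scoped ContDiff

namespace QC

/-- `f` is locally square integrable: `f ∈ L²(K)` for every compact set `K`. -/
def MemL2Loc {X : Type*} [TopologicalSpace X] [MeasureSpace X] (f : X → ℂ) : Prop :=
  ∀ K : Set X, IsCompact K → MemLp f 2 (volume.restrict K)

/-- `g` is the weak (distributional) derivative of `f : ℂ → ℂ` in the direction `v`, tested
against smooth compactly supported functions; `v = 1` and `v = Complex.I` give the partial
derivatives with respect to `x` and `y`. -/
def HasWeakDeriv (f : ℂ → ℂ) (v : ℂ) (g : ℂ → ℂ) : Prop :=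
  LocallyIntegrable f ∧ LocallyIntegrable g ∧
    ∀ φ : ℂ → ℂ, ContDiff ℝ ∞ φ → HasCompactSupport φ →
      ∫ z, f z * fderiv ℝ φ z v = -∫ z, g z * φ z

/-- `f` is in the Sobolev class `W^{1,2}_loc(ℂ)`. -/
def MemW12Loc (f : ℂ → ℂ) : Prop :=
  MemL2Loc f ∧ ∃ fx fy : ℂ → ℂ, HasWeakDeriv f 1 fx ∧ HasWeakDeriv f Complex.I fy ∧
    MemL2Loc fx ∧ MemL2Loc fy

/-- `g = ∂f = (f_x - i f_y) / 2` in the weak sense. -/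
def IsWeakDz (f g : ℂ → ℂ) : Prop :=
  ∃ fx fy : ℂ → ℂ, HasWeakDeriv f 1 fx ∧ HasWeakDeriv f Complex.I fy ∧
    ∀ᵐ z, g z = (fx z - Complex.I * fy z) / 2

/-- `g = ∂̄f = (f_x + i f_y) / 2` in the weak sense. -/
def IsWeakDzbar (f g : ℂ → ℂ) : Prop :=
  ∃ fx fy : ℂ → ℂ, HasWeakDeriv f 1 fx ∧ HasWeakDeriv f Complex.I fy ∧
    ∀ᵐ z, g z = (fx z + Complex.I * fy z) / 2

/-- Orientation preservation for a homeomorphism of the plane: the image of every positively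
oriented circle has winding number `1` around the image of its centre, the winding number being
read off a continuous choice `θ` of the argument. -/
def PreservesOrientation (f : ℂ → ℂ) : Prop :=
  ∀ (c : ℂ) (r : ℝ), 0 < r → ∃ θ : ℝ → ℝ, Continuous θ ∧
    (∀ t : ℝ, f (circleMap c r t) - f c =
      ‖f (circleMap c r t) - f c‖ * Complex.exp (θ t * Complex.I)) ∧
    θ (2 * Real.pi) - θ 0 = 2 * Real.pi

/-- Quasiconformal mappings of the plane: orientation preserving homeomorphisms of class
`W^{1,2}_loc` which solve a Beltrami equation `∂̄ρ = μ ∂ρ` with `‖μ‖_∞ < 1`. -/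
structure IsQuasiconformal (ρ : ℂ → ℂ) : Prop where
  isHomeomorph : IsHomeomorph ρ
  preservesOrientation : PreservesOrientation ρ
  memW12Loc : MemW12Loc ρ
  beltrami : ∃ μ p q : ℂ → ℂ, Measurable μ ∧ eLpNorm μ ⊤ volume < 1 ∧
    IsWeakDz ρ p ∧ IsWeakDzbar ρ q ∧ ∀ᵐ z, q z = μ z * p z

/-- Analyticity at `∞` of a homeomorphism of the plane, extended to the Riemann sphere by
`ρ(∞) = ∞`: in the coordinate `w = 1/z` at `∞`, the map `w ↦ 1/ρ(1/w)`, `0 ↦ 0`, is analytic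
at `0`. -/
def AnalyticAtInfty (ρ : ℂ → ℂ) : Prop :=
  AnalyticAt ℂ (Function.update (fun w : ℂ => (ρ w⁻¹)⁻¹) 0 0) 0

/-- The curve parametrized by `γ` is locally rectifiable: each compact subarc `γ([a, b])` has
finite length. -/
def IsLocallyRectifiable (γ : ℝ → ℂ) : Prop :=
  ∀ a b : ℝ, eVariationOn γ (Set.Icc a b) < ⊤

end QC

/-! Near a compact interval of the real line, a multiple of `ρ x` is by Cauchy–Pompeiu the integral
of `(χ ∂̄ρ + ρ ∂̄χ)(w) / (x - w)`, with `χ` a cutoff (`QC.IsWeakDzbar.cauchy_pompeiu`). The density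
`ρ ∂̄χ` stays away from the interval and contributes a function with bounded derivative there. The
regularity question concerns `g = χ ∂̄ρ`, treated separately in the two half planes.

The formal derivative of that piece is `-∫ g(w) / (x - w)²`. Its squared `L²(ℝ)` norm is a double
integral of `g(w) conj g(w')` against `∫ dx / ((x - w)² (x - conj w')²)`. For `w`, `w'` in the same
half plane this kernel is `O(|w - conj w'|⁻³)`, and a majorant of it integrates in `w'` to `O(1 /
|Im w|)`. Schur's test then bounds the norm by `∫ |g|² / |y|`, the hypothesis of the theorem
(`lintegral_cauchySq_sq_le`).

Since `g` may accumulate at the line, it is first restricted to `|Im w| ≥ 1 / (n + 1)`, where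
differentiation under the integral is legitimate. The bound is uniform in `n`, and pointwise limits
of primitives of functions bounded in `L²` are absolutely continuous with `L²` derivative
(`regularity_of_isL2PrimitiveLimit`). -/

/-! ### Limits of primitives of functions bounded in L² -/

theorem sq_setLIntegral_le {α : Type*} [MeasurableSpace α] {μ : Measure α} (s : Set α)
    {u : α → ENNReal} (hu : AEMeasurable u (μ.restrict s)) :
    (∫⁻ x in s, u x ∂μ) ^ 2 ≤ μ s * ∫⁻ x in s, u x ^ 2 ∂μ := by
  have h := ENNReal.lintegral_mul_le_Lp_mul_Lq (μ.restrict s) Real.HolderConjugate.two_two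
    (f := fun _ => 1) aemeasurable_const hu
  simp only [Pi.mul_apply, one_mul, lintegral_const, Measure.restrict_apply_univ,
    ENNReal.rpow_two, one_pow] at h
  calc _ ≤ (μ s ^ (1 / 2 : ℝ) * (∫⁻ x in s, u x ^ 2 ∂μ) ^ (1 / 2 : ℝ)) ^ 2 := by gcongr
    _ = _ := by
      rw [mul_pow, ← ENNReal.rpow_two, ← ENNReal.rpow_two, ← ENNReal.rpow_mul,
        ← ENNReal.rpow_mul]
      norm_num

/-- `f` is on `[a, b]` the pointwise limit of functions whose derivatives are bounded
in `L²(a, b)`. -/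
structure IsL2PrimitiveLimit (f : ℝ → ℂ) (a b : ℝ) (F T : ℕ → ℝ → ℂ) (M : ENNReal) : Prop where
  tendsto : ∀ x ∈ Set.Icc a b, Filter.Tendsto (fun n => F n x) Filter.atTop (nhds (f x))
  sub_eq : ∀ n, ∀ c ∈ Set.Icc a b, ∀ d ∈ Set.Icc a b, F n d - F n c = ∫ t in c..d, T n t
  measurable : ∀ n, Measurable (T n)
  bound : ∀ n, ∫⁻ t in Set.Icc a b, ‖T n t‖ₑ ^ 2 ≤ M
  lt_top : M < ⊤

namespace IsL2PrimitiveLimit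

variable {f : ℝ → ℂ} {a b : ℝ} {F T : ℕ → ℝ → ℂ} {M : ENNReal}

theorem enorm_sub_le (h : IsL2PrimitiveLimit f a b F T M) (n : ℕ) {c d : ℝ}
    (hc : c ∈ Set.Icc a b) (hd : d ∈ Set.Icc a b) :
    ‖F n d - F n c‖ₑ ≤ ∫⁻ t in Set.uIoc c d, ‖T n t‖ₑ := by
  rw [h.sub_eq n c hc d hd, ← ofReal_norm, intervalIntegral.norm_intervalIntegral_eq,
    ofReal_norm]
  exact enorm_integral_le_lintegral_enorm _

theorem uIoc_subset {c d : ℝ} (hc : c ∈ Set.Icc a b) (hd : d ∈ Set.Icc a b) :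
    Set.uIoc c d ⊆ Set.Icc a b :=
  Set.uIoc_subset_uIcc.trans (Set.uIcc_subset_Icc hc hd)

/-- Cauchy–Schwarz on the union of the disjoint intervals, for each approximant; the bound does not
depend on `n`, so it passes to the pointwise limit. This is absolute continuity in quantitative
form. -/
theorem sq_sum_le (h : IsL2PrimitiveLimit f a b F T M) (N : ℕ) (I : ℕ → ℝ × ℝ)
    (hI : (N, I) ∈ AbsolutelyContinuousOnInterval.disjWithin a b) (hab : a ≤ b) :
    (∑ i ∈ Finset.range N, ENNReal.ofReal (dist (f (I i).1) (f (I i).2))) ^ 2 ≤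
      (∑ i ∈ Finset.range N, ENNReal.ofReal (dist (I i).1 (I i).2)) * M := by
  obtain ⟨hmem, hdisj⟩ := hI
  simp only [Set.uIcc_of_le hab] at hmem
  have hlim : Filter.Tendsto
      (fun n => (∑ i ∈ Finset.range N, ENNReal.ofReal (dist (F n (I i).1) (F n (I i).2))) ^ 2)
      Filter.atTop
      (nhds ((∑ i ∈ Finset.range N, ENNReal.ofReal (dist (f (I i).1) (f (I i).2))) ^ 2)) := by
    refine (ENNReal.continuous_pow 2).continuousAt.tendsto.comp (tendsto_finsetSum _ fun i hi => ?_)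
    exact ENNReal.tendsto_ofReal ((h.tendsto _ (hmem i hi).1).dist (h.tendsto _ (hmem i hi).2))
  refine le_of_tendsto' hlim fun n => ?_
  set S : Set ℝ := ⋃ i ∈ Finset.range N, Set.uIoc (I i).1 (I i).2 with hS
  have hSsub : S ⊆ Set.Icc a b :=
    Set.iUnion₂_subset fun i hi => uIoc_subset (hmem i hi).1 (hmem i hi).2
  calc (∑ i ∈ Finset.range N, ENNReal.ofReal (dist (F n (I i).1) (F n (I i).2))) ^ 2
      ≤ (∑ i ∈ Finset.range N, ∫⁻ t in Set.uIoc (I i).1 (I i).2, ‖T n t‖ₑ) ^ 2 := by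
        gcongr with i hi
        rw [dist_comm, dist_eq_norm, ofReal_norm]
        exact h.enorm_sub_le n (hmem i hi).1 (hmem i hi).2
    _ = (∫⁻ t in S, ‖T n t‖ₑ) ^ 2 := by
        rw [hS, lintegral_biUnion_finset hdisj (fun i _ => measurableSet_uIoc)]
    _ ≤ volume S * ∫⁻ t in S, ‖T n t‖ₑ ^ 2 :=
        sq_setLIntegral_le S (h.measurable n).enorm.aemeasurable
    _ ≤ _ := by
        gcongr
        · rw [hS, measure_biUnion_finset hdisj (fun i _ => measurableSet_uIoc)]
          refine Finset.sum_le_sum fun i _ => ?_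
          rw [Real.volume_uIoc, dist_comm, Real.dist_eq]
        · exact (lintegral_mono_set hSsub).trans (h.bound n)

theorem absolutelyContinuousOnInterval (h : IsL2PrimitiveLimit f a b F T M) (hab : a ≤ b) :
    AbsolutelyContinuousOnInterval f a b := by
  rw [absolutelyContinuousOnInterval_iff]
  intro ε hε
  -- The `+ 1` keeps the denominator positive when `M = 0`.
  refine ⟨ε ^ 2 / (M.toReal + 1), by positivity, fun (N, I) hI hlt => ?_⟩
  have hsq := h.sq_sum_le N I hI hab
  rw [← ENNReal.ofReal_sum_of_nonneg (fun _ _ => dist_nonneg),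
    ← ENNReal.ofReal_sum_of_nonneg (fun _ _ => dist_nonneg), ← ENNReal.ofReal_pow
      (Finset.sum_nonneg fun _ _ => dist_nonneg), ← ENNReal.ofReal_toReal h.lt_top.ne,
    ← ENNReal.ofReal_mul (Finset.sum_nonneg fun _ _ => dist_nonneg),
    ENNReal.ofReal_le_ofReal_iff (mul_nonneg (Finset.sum_nonneg fun _ _ => dist_nonneg)
      ENNReal.toReal_nonneg)] at hsq
  refine lt_of_pow_lt_pow_left₀ 2 hε.le (hsq.trans_lt ?_)
  have h1 : (0 : ℝ) < M.toReal + 1 := by positivity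
  rw [lt_div_iff₀ h1] at hlt
  refine lt_of_le_of_lt ?_ hlt
  gcongr
  linarith

/-- The energies of `T n` on `(c, d]` need not converge, hence the lower limit. They are kept local
here because the next use integrates over the position of the interval. -/
theorem enorm_sub_sq_le (h : IsL2PrimitiveLimit f a b F T M) {c d : ℝ}
    (hc : c ∈ Set.Icc a b) (hd : d ∈ Set.Icc a b) (hcd : c ≤ d) :
    ‖f d - f c‖ₑ ^ 2 ≤ Filter.liminf
      (fun n => ENNReal.ofReal (d - c) * ∫⁻ t in Set.Ioc c d, ‖T n t‖ₑ ^ 2) Filter.atTop := by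
  have hlim : Filter.Tendsto (fun n => ‖F n d - F n c‖ₑ ^ 2) Filter.atTop
      (nhds (‖f d - f c‖ₑ ^ 2)) :=
    (ENNReal.continuous_pow 2).continuousAt.tendsto.comp
      ((h.tendsto d hd).sub (h.tendsto c hc)).enorm
  rw [← hlim.liminf_eq]
  refine Filter.liminf_le_liminf (Filter.Eventually.of_forall fun n => ?_)
  have h1 := h.enorm_sub_le n hc hd
  rw [Set.uIoc_of_le hcd] at h1
  calc _ ≤ (∫⁻ t in Set.Ioc c d, ‖T n t‖ₑ) ^ 2 := by gcongr
    _ ≤ volume (Set.Ioc c d) * ∫⁻ t in Set.Ioc c d, ‖T n t‖ₑ ^ 2 := sq_setLIntegral_le _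
        (h.measurable n).enorm.aemeasurable
    _ = _ := by rw [Real.volume_Ioc]

/-- Tonelli: a point `t` lies in `(x, x + s]` for a set of `x` of length `s`. -/
theorem lintegral_setLIntegral_Ioc_le {v : ℝ → ENNReal} (hv : Measurable v) {s : ℝ} :
    ∫⁻ x, ∫⁻ t in Set.Ioc x (x + s), v t ≤ ENNReal.ofReal s * ∫⁻ t, v t := by
  have hshift : ∀ x, ∫⁻ t in Set.Ioc x (x + s), v t = ∫⁻ r in Set.Ioc 0 s, v (x + r) := by
    intro x
    rw [← lintegral_indicator measurableSet_Ioc, ← lintegral_indicator measurableSet_Ioc,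
      ← lintegral_add_left_eq_self _ x]
    congr 1 with r
    simp only [Set.indicator_apply, Set.mem_Ioc, lt_add_iff_pos_right, add_le_add_iff_left]
  simp_rw [hshift]
  rw [lintegral_lintegral_swap (by fun_prop)]
  simp_rw [lintegral_add_right_eq_self v]
  simp [mul_comm]

theorem measurable_setLIntegral_Ioc {v : ℝ → ENNReal} (hv : Measurable v) (s : ℝ) :
    Measurable fun x => ∫⁻ t in Set.Ioc x (x + s), v t := by
  simp_rw [← lintegral_indicator measurableSet_Ioc]
  refine Measurable.lintegral_prod_right'
    (f := fun p : ℝ × ℝ => (Set.Ioc p.1 (p.1 + s)).indicator v p.2) ?_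
  have : (fun p : ℝ × ℝ => (Set.Ioc p.1 (p.1 + s)).indicator v p.2) =
      {p : ℝ × ℝ | p.1 < p.2 ∧ p.2 ≤ p.1 + s}.indicator (fun p => v p.2) := by
    ext p
    simp [Set.indicator_apply]
  rw [this]
  refine (hv.comp measurable_snd).indicator ?_
  exact (measurableSet_lt measurable_fst measurable_snd).inter
    (measurableSet_le measurable_snd (measurable_fst.add_const s))

/-- One factor `s` comes from Cauchy–Schwarz on each window, the other from averaging over windows;
Fatou removes the lower limit. The interval reaches to `b + 1` so that `x + s` stays inside. -/
theorem lintegral_enorm_sub_sq_le (h : IsL2PrimitiveLimit f a (b + 1) F T M) {s : ℝ}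
    (hs : 0 < s) (hs1 : s ≤ 1) :
    ∫⁻ x in Set.Icc a b, ‖f (x + s) - f x‖ₑ ^ 2 ≤ ENNReal.ofReal s ^ 2 * M := by
  set v : ℕ → ℝ → ENNReal := fun n => (Set.Icc a (b + 1)).indicator fun t => ‖T n t‖ₑ ^ 2
  have hv : ∀ n, Measurable (v n) := fun n =>
    ((h.measurable n).enorm.pow_const 2).indicator measurableSet_Icc
  calc ∫⁻ x in Set.Icc a b, ‖f (x + s) - f x‖ₑ ^ 2
      ≤ ∫⁻ x in Set.Icc a b, Filter.liminf
          (fun n => ENNReal.ofReal s * ∫⁻ t in Set.Ioc x (x + s), v n t) Filter.atTop := by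
        refine setLIntegral_mono' measurableSet_Icc fun x hx => ?_
        have hx1 : x ∈ Set.Icc a (b + 1) := ⟨hx.1, by linarith [hx.2]⟩
        have hx2 : x + s ∈ Set.Icc a (b + 1) := ⟨by linarith [hx.1], by linarith [hx.2]⟩
        refine (h.enorm_sub_sq_le hx1 hx2 (by linarith)).trans_eq ?_
        congr 1 with n
        rw [add_sub_cancel_left]
        congr 1
        refine setLIntegral_congr_fun measurableSet_Ioc fun t ht => ?_
        have hmem : t ∈ Set.Icc a (b + 1) := ⟨hx.1.trans ht.1.le, ht.2.trans hx2.2⟩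
        simp only [v, Set.indicator_of_mem hmem]
    _ ≤ Filter.liminf (fun n => ∫⁻ x in Set.Icc a b,
          ENNReal.ofReal s * ∫⁻ t in Set.Ioc x (x + s), v n t) Filter.atTop :=
        lintegral_liminf_le fun n => (measurable_setLIntegral_Ioc (hv n) s).const_mul _
    _ ≤ Filter.liminf (fun _ : ℕ => ENNReal.ofReal s ^ 2 * M) Filter.atTop := by
        refine Filter.liminf_le_liminf (Filter.Eventually.of_forall fun n => ?_)
        rw [lintegral_const_mul _ (measurable_setLIntegral_Ioc (hv n) s), sq, mul_assoc]
        gcongr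
        refine ((setLIntegral_le_lintegral _ _).trans
          (lintegral_setLIntegral_Ioc_le (hv n))).trans ?_
        gcongr
        rw [lintegral_indicator measurableSet_Icc]
        exact h.bound n
    _ = _ := Filter.liminf_const _

/-- Fatou along the difference quotients with steps `1 / (n + 1)`; no weak compactness of the `T n`
is needed. -/
theorem lintegral_deriv_sq_le (h : IsL2PrimitiveLimit f a (b + 1) F T M) (hf : Continuous f)
    (hd : ∀ᵐ x : ℝ, DifferentiableAt ℝ f x) :
    ∫⁻ x in Set.Icc a b, ‖deriv f x‖ₑ ^ 2 ≤ M := by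
  set s : ℕ → ℝ := fun n => 1 / ((n : ℝ) + 1)
  have hs : ∀ n, 0 < s n := fun n => Nat.one_div_pos_of_nat
  have hs1 : ∀ n, s n ≤ 1 := fun n => by
    simp only [s]
    rw [div_le_one (by positivity)]
    linarith [(Nat.cast_nonneg n : (0 : ℝ) ≤ n)]
  have hs0 : Filter.Tendsto s Filter.atTop (nhdsWithin 0 {0}ᶜ) :=
    tendsto_nhdsWithin_iff.2 ⟨tendsto_one_div_add_atTop_nhds_zero_nat,
      Filter.Eventually.of_forall fun n => (hs n).ne'⟩
  calc ∫⁻ x in Set.Icc a b, ‖deriv f x‖ₑ ^ 2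
      = ∫⁻ x in Set.Icc a b, Filter.liminf
          (fun n => ‖(s n)⁻¹ • (f (x + s n) - f x)‖ₑ ^ 2) Filter.atTop := by
        refine lintegral_congr_ae (ae_restrict_of_ae ?_)
        filter_upwards [hd] with x hx
        refine (Filter.Tendsto.liminf_eq ?_).symm
        exact (ENNReal.continuous_pow 2).continuousAt.tendsto.comp
          (hx.hasDerivAt.tendsto_slope_zero.comp hs0).enorm
    _ ≤ Filter.liminf (fun n => ∫⁻ x in Set.Icc a b,
          ‖(s n)⁻¹ • (f (x + s n) - f x)‖ₑ ^ 2) Filter.atTop :=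
        lintegral_liminf_le fun n => by fun_prop
    _ ≤ Filter.liminf (fun _ : ℕ => M) Filter.atTop := by
        refine Filter.liminf_le_liminf (Filter.Eventually.of_forall fun n => ?_)
        simp_rw [enorm_smul, mul_pow]
        rw [lintegral_const_mul _ (by fun_prop)]
        refine (mul_le_mul_right (h.lintegral_enorm_sub_sq_le (hs n) (hs1 n)) _).trans_eq ?_
        rw [← mul_assoc, ← mul_pow, Real.enorm_of_nonneg (inv_nonneg.2 (hs n).le),
          ← ENNReal.ofReal_mul (inv_nonneg.2 (hs n).le), inv_mul_cancel₀ (hs n).ne']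
        simp
    _ = _ := Filter.liminf_const _

end IsL2PrimitiveLimit

/-- A continuous function that is on each compact interval a limit of primitives of functions
bounded in `L²` is locally absolutely continuous with locally square integrable derivative. -/
theorem regularity_of_isL2PrimitiveLimit {f : ℝ → ℂ} (hf : Continuous f)
    (h : ∀ R : ℝ, 0 < R → ∃ F T M, IsL2PrimitiveLimit f (-R) R F T M) :
    QC.IsLocallyRectifiable f ∧ (∀ a b : ℝ, AbsolutelyContinuousOnInterval f a b) ∧
    (∀ᵐ x : ℝ, DifferentiableAt ℝ f x) ∧ QC.MemL2Loc (deriv f) := by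
  have hac : ∀ a b : ℝ, AbsolutelyContinuousOnInterval f a b := by
    intro a b
    obtain ⟨F, T, M, hR⟩ := h (|a| + |b| + 1) (by positivity)
    have hle : -(|a| + |b| + 1) ≤ |a| + |b| + 1 := by
      linarith [abs_nonneg a, abs_nonneg b]
    refine (hR.absolutelyContinuousOnInterval hle).mono ?_
    rw [Set.uIcc_of_le hle]
    refine Set.uIcc_subset_Icc ⟨?_, ?_⟩ ⟨?_, ?_⟩ <;>
      linarith [abs_nonneg a, abs_nonneg b, le_abs_self a, le_abs_self b, neg_abs_le a,
        neg_abs_le b]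
  have hbv : ∀ a b : ℝ, eVariationOn f (Set.Icc a b) < ⊤ := by
    intro a b
    rcases le_total a b with hab | hab
    · have := (hac a b).boundedVariationOn
      rw [Set.uIcc_of_le hab] at this
      exact this.lt_top
    · rw [eVariationOn.subsingleton _ (Set.subsingleton_Icc_of_ge hab)]
      exact ENNReal.zero_lt_top
  have hd : ∀ᵐ x : ℝ, DifferentiableAt ℝ f x := by
    refine LocallyBoundedVariationOn.ae_differentiableAt fun a b _ _ => ?_
    rw [Set.univ_inter]
    exact (hbv a b).ne
  refine ⟨hbv, hac, hd, fun K hK => ?_⟩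
  obtain ⟨r, hr0, hr⟩ := hK.isBounded.subset_closedBall_lt 0 0
  -- One unit more than `r`, for the room to the right required by `lintegral_deriv_sq_le`.
  obtain ⟨F, T, M, hR⟩ := h (r + 1) (by linarith)
  have hsub : K ⊆ Set.Icc (-(r + 1)) r := fun x hx => by
    have := hr hx
    rw [Metric.mem_closedBall, dist_zero_right, Real.norm_eq_abs, abs_le] at this
    exact ⟨by linarith, this.2⟩
  refine ⟨(measurable_deriv f).aestronglyMeasurable, ?_⟩
  rw [eLpNorm_lt_top_iff_lintegral_rpow_enorm_lt_top two_ne_zero ENNReal.ofNat_ne_top]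
  simp only [ENNReal.toReal_ofNat, ENNReal.rpow_two]
  exact (lintegral_mono_set hsub).trans_lt
    ((hR.lintegral_deriv_sq_le hf hd).trans_lt hR.lt_top)

/-! ### Poisson-type integrals and the majorant kernel -/

theorem integrable_inv_sub_sq_add_sq (α : ℝ) {β : ℝ} (hβ : 0 < β) :
    Integrable fun x : ℝ => ((x - α) ^ 2 + β ^ 2)⁻¹ := by
  have h := ((integrable_inv_one_add_sq.comp_div hβ.ne').comp_sub_right α).const_mul (β ^ 2)⁻¹
  refine h.congr (Filter.Eventually.of_forall fun x => ?_)
  simp only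
  field_simp
  ring

theorem integral_inv_sub_sq_add_sq (α : ℝ) {β : ℝ} (hβ : 0 < β) :
    ∫ x : ℝ, ((x - α) ^ 2 + β ^ 2)⁻¹ = Real.pi / β := by
  have h : ∀ x : ℝ, ((x - α) ^ 2 + β ^ 2)⁻¹ = (β ^ 2)⁻¹ * (1 + ((x - α) / β) ^ 2)⁻¹ := by
    intro x
    field_simp
    ring
  simp_rw [h]
  rw [integral_const_mul, integral_sub_right_eq_self (fun x => (1 + (x / β) ^ 2)⁻¹) α,
    Measure.integral_comp_div (fun x => (1 + x ^ 2)⁻¹) β, integral_univ_inv_one_add_sq,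
    abs_of_pos hβ, smul_eq_mul]
  field_simp

theorem lintegral_inv_sub_sq_add_sq (α : ℝ) {β : ℝ} (hβ : 0 < β) :
    ∫⁻ x : ℝ, ENNReal.ofReal ((x - α) ^ 2 + β ^ 2)⁻¹ = ENNReal.ofReal (Real.pi / β) := by
  rw [← integral_inv_sub_sq_add_sq α hβ, ofReal_integral_eq_lintegral_ofReal
    (integrable_inv_sub_sq_add_sq α hβ) (Filter.Eventually.of_forall fun x => by positivity)]

theorem lintegral_complex_eq {F : ℂ → ENNReal} (hF : Measurable F) :
    ∫⁻ w, F w = ∫⁻ y : ℝ, ∫⁻ x : ℝ, F ⟨x, y⟩ := by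
  rw [← (Complex.volume_preserving_equiv_real_prod.symm).lintegral_comp hF,
    Measure.volume_eq_prod, lintegral_prod_symm']
  · rfl
  · exact hF.comp (MeasurableEquiv.measurable _)

/-- The majorant `1 / (t (s² + t²))`, with `s = Re (w - w')` and `t = |Im w| + |Im w'|`, of the
kernel `1 / |w - conj w'|³`. -/
noncomputable def cubicKernel (w w' : ℂ) : ℝ :=
  (|w.im| + |w'.im|)⁻¹ * ((w'.re - w.re) ^ 2 + (|w.im| + |w'.im|) ^ 2)⁻¹

theorem cubicKernel_comm (w w' : ℂ) : cubicKernel w w' = cubicKernel w' w := by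
  simp only [cubicKernel]
  rw [add_comm |w.im|]
  congr 2
  ring

@[fun_prop]
theorem measurable_cubicKernel : Measurable fun p : ℂ × ℂ => cubicKernel p.1 p.2 := by
  have h : Measurable fun z : ℂ => |z.im| := Complex.measurable_im.abs
  have h1 : Measurable fun p : ℂ × ℂ => |p.1.im| + |p.2.im| :=
    (h.comp measurable_fst).add (h.comp measurable_snd)
  exact h1.inv.mul ((((Complex.measurable_re.comp measurable_snd).sub
    (Complex.measurable_re.comp measurable_fst)).pow_const 2).add (h1.pow_const 2)).inv

/-- The row bound for Schur's test. Integrating in the real part gives `π / t²` with `t = |Im w| +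
|y|`; then `t² ≥ y² + |Im w|²` leads to a second integral of the same type, in `y`. -/
theorem lintegral_cubicKernel_le {w : ℂ} (hw : w.im ≠ 0) :
    ∫⁻ w', ENNReal.ofReal (cubicKernel w w') ≤ ENNReal.ofReal (Real.pi ^ 2 / |w.im|) := by
  have hw' : 0 < |w.im| := abs_pos.2 hw
  rw [lintegral_complex_eq (F := fun w' => ENNReal.ofReal (cubicKernel w w'))
    (measurable_cubicKernel.comp measurable_prodMk_left).ennreal_ofReal]
  have hinner : ∀ y : ℝ, ∫⁻ x : ℝ, ENNReal.ofReal (cubicKernel w ⟨x, y⟩) ≤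
      ENNReal.ofReal Real.pi * ENNReal.ofReal ((y - 0) ^ 2 + |w.im| ^ 2)⁻¹ := by
    intro y
    have ht : 0 < |w.im| + |y| := by positivity
    simp only [cubicKernel]
    simp_rw [ENNReal.ofReal_mul (inv_nonneg.2 ht.le)]
    rw [lintegral_const_mul _ (by fun_prop), lintegral_inv_sub_sq_add_sq _ ht,
      ← ENNReal.ofReal_mul (inv_nonneg.2 ht.le), ← ENNReal.ofReal_mul Real.pi_pos.le]
    refine ENNReal.ofReal_le_ofReal ?_
    have : (|w.im| + |y|)⁻¹ * (Real.pi / (|w.im| + |y|)) =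
        Real.pi * ((|w.im| + |y|) ^ 2)⁻¹ := by
      field_simp
    rw [this]
    gcongr
    nlinarith [abs_nonneg y, sq_abs y]
  refine (lintegral_mono hinner).trans_eq ?_
  rw [lintegral_const_mul _ (by fun_prop), lintegral_inv_sub_sq_add_sq 0 hw',
    ← ENNReal.ofReal_mul Real.pi_pos.le]
  congr 1
  ring

/-! ### The integral of 1 / ((x - a)² (x - c)²) over the line -/

theorem ofReal_sub_ne_zero {a : ℂ} (ha : a.im ≠ 0) (x : ℝ) : (x : ℂ) - a ≠ 0 := fun h =>
  ha (by simpa using congrArg Complex.im h)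

theorem sq_norm_ofReal_sub (x : ℝ) (a : ℂ) : ‖(x : ℂ) - a‖ ^ 2 = (x - a.re) ^ 2 + |a.im| ^ 2 := by
  rw [Complex.sq_norm, Complex.normSq_apply, sq_abs]
  simp
  ring

theorem abs_im_le_norm_ofReal_sub (x : ℝ) (a : ℂ) : |a.im| ≤ ‖(x : ℂ) - a‖ := by
  simpa using Complex.abs_im_le_norm ((x : ℂ) - a)

theorem norm_inv_sq_mul_inv_sq_le {a c : ℂ} {δ : ℝ} (hδ : 0 < δ) (hc : δ ≤ |c.im|) (x : ℝ) :
    ‖(((x : ℂ) - a) ^ 2)⁻¹ * (((x : ℂ) - c) ^ 2)⁻¹‖ ≤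
      ((x - a.re) ^ 2 + |a.im| ^ 2)⁻¹ * (δ ^ 2)⁻¹ := by
  rw [norm_mul, norm_inv, norm_inv, norm_pow, norm_pow, sq_norm_ofReal_sub x a]
  gcongr
  exact hc.trans (abs_im_le_norm_ofReal_sub x c)

theorem integrable_inv_sq_mul_inv_sq {a c : ℂ} (ha : a.im ≠ 0) (hc : c.im ≠ 0) :
    Integrable fun x : ℝ => (((x : ℂ) - a) ^ 2)⁻¹ * (((x : ℂ) - c) ^ 2)⁻¹ := by
  refine ((integrable_inv_sub_sq_add_sq a.re (abs_pos.2 ha)).mul_const (|c.im| ^ 2)⁻¹).mono'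
    ?_ (Filter.Eventually.of_forall
      fun x => norm_inv_sq_mul_inv_sq_le (abs_pos.2 hc) le_rfl x)
  exact Measurable.aestronglyMeasurable (by fun_prop)

/-- The real part tends to `0` along the line, and the arguments are bounded crudely by `π` each.
Not following the argument costs only a constant. -/
theorem norm_clog_sub_clog_le {z z' : ℂ} (hz : z ≠ 0) (hz' : z' ≠ 0) :
    ‖Complex.log z - Complex.log z'‖ ≤ |Real.log (‖z‖ / ‖z'‖)| + 2 * Real.pi := by
  refine (Complex.norm_le_abs_re_add_abs_im _).trans ?_
  simp only [Complex.sub_re, Complex.sub_im, Complex.log_re, Complex.log_im]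
  rw [Real.log_div (norm_ne_zero_iff.2 hz) (norm_ne_zero_iff.2 hz')]
  gcongr
  refine (abs_sub _ _).trans ?_
  linarith [Complex.abs_arg_le_pi z, Complex.abs_arg_le_pi z']

/-- A primitive on the real line of `1 / ((x - a)² (x - c)²)`. -/
noncomputable def invSqPrimitive (a c : ℂ) (x : ℝ) : ℂ :=
  ((a - c) ^ 2)⁻¹ * (-((x : ℂ) - a)⁻¹ - ((x : ℂ) - c)⁻¹ -
    2 * (a - c)⁻¹ * (Complex.log (x - a) - Complex.log (x - c)))

theorem hasDerivAt_invSqPrimitive {a c : ℂ} (ha : a.im ≠ 0) (hc : c.im ≠ 0) (hac : a ≠ c)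
    (x : ℝ) : HasDerivAt (invSqPrimitive a c)
      ((((x : ℂ) - a) ^ 2)⁻¹ * (((x : ℂ) - c) ^ 2)⁻¹) x := by
  have ha0 := ofReal_sub_ne_zero ha x
  have hc0 := ofReal_sub_ne_zero hc x
  have hac0 : a - c ≠ 0 := sub_ne_zero.2 hac
  have hd : ∀ b : ℂ, HasDerivAt (fun x : ℝ => (x : ℂ) - b) 1 x := fun b =>
    (Complex.ofRealCLM.hasDerivAt (x := x)).sub_const b
  -- On the real line `x - b` is never real, so the principal logarithm is differentiable all along
  -- it.
  have hslit : ∀ b : ℂ, b.im ≠ 0 → (x : ℂ) - b ∈ Complex.slitPlane := fun b hb =>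
    Or.inr (by simpa using hb)
  have h := ((((hd a).fun_inv ha0).fun_neg.fun_sub ((hd c).fun_inv hc0)).fun_sub
    ((((hd a).clog_real (hslit a ha)).fun_sub ((hd c).clog_real (hslit c hc))).const_mul
      (2 * (a - c)⁻¹))).const_mul ((a - c) ^ 2)⁻¹
  refine h.congr_deriv ?_
  field_simp
  ring

theorem tendsto_inv_ofReal_sub {l : Filter ℝ} (hl : Filter.Tendsto (fun x : ℝ => |x|) l Filter.atTop)
    (b : ℂ) : Filter.Tendsto (fun x : ℝ => ((x : ℂ) - b)⁻¹) l (nhds 0) := by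
  refine Filter.tendsto_inv₀_cobounded.comp (tendsto_norm_atTop_iff_cobounded.1 ?_)
  refine Filter.tendsto_atTop_mono (fun x => ?_) (Filter.tendsto_atTop_add_const_right l (-‖b‖) hl)
  have := norm_sub_norm_le (x : ℂ) b
  rw [Complex.norm_real, Real.norm_eq_abs] at this
  linarith

/-- A convergent majorant suffices, so the limits of the arguments are never computed. Only the term
`2 |a - c|⁻¹ · 2π` survives at infinity. The filter `l` stands for either end of the line. -/
theorem exists_tendsto_norm_invSqPrimitive_le {a c : ℂ} (ha : a.im ≠ 0) (hc : c.im ≠ 0)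
    {l : Filter ℝ} (hl : Filter.Tendsto (fun x : ℝ => |x|) l Filter.atTop) :
    ∃ B : ℝ → ℝ, (∀ x, ‖invSqPrimitive a c x‖ ≤ B x) ∧
      Filter.Tendsto B l (nhds (4 * Real.pi * (‖a - c‖ ^ 3)⁻¹)) := by
  refine ⟨fun x => (‖a - c‖ ^ 2)⁻¹ * (‖((x : ℂ) - a)⁻¹‖ + ‖((x : ℂ) - c)⁻¹‖ +
    2 * ‖a - c‖⁻¹ * (|Real.log (‖(x : ℂ) - a‖ / ‖(x : ℂ) - c‖)| + 2 * Real.pi)), fun x => ?_, ?_⟩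
  · dsimp only
    rw [invSqPrimitive, norm_mul, norm_inv, norm_pow]
    gcongr
    refine (norm_sub_le _ _).trans (add_le_add ((norm_sub_le _ _).trans ?_) ?_)
    · rw [norm_neg]
    · rw [norm_mul, norm_mul, norm_inv, Complex.norm_ofNat]
      gcongr
      exact norm_clog_sub_clog_le (ofReal_sub_ne_zero ha x) (ofReal_sub_ne_zero hc x)
  · have hratio : Filter.Tendsto (fun x : ℝ => ‖(x : ℂ) - a‖ / ‖(x : ℂ) - c‖) l (nhds 1) := by
      have h1 : Filter.Tendsto (fun x : ℝ => 1 + (c - a) * ((x : ℂ) - c)⁻¹) l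
          (nhds (1 + (c - a) * 0)) := ((tendsto_inv_ofReal_sub hl c).const_mul _).const_add _
      have h2 := h1.norm
      simp only [mul_zero, add_zero, norm_one] at h2
      refine h2.congr fun x => ?_
      rw [← norm_div]
      congr 1
      have := ofReal_sub_ne_zero hc x
      field_simp
      ring
    have hlog : Filter.Tendsto (fun x : ℝ => |Real.log (‖(x : ℂ) - a‖ / ‖(x : ℂ) - c‖)|) l
        (nhds 0) := by
      simpa using (hratio.log one_ne_zero).abs
    have h := (((tendsto_inv_ofReal_sub hl a).norm.add (tendsto_inv_ofReal_sub hl c).norm).add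
      ((hlog.add_const (2 * Real.pi)).const_mul (2 * ‖a - c‖⁻¹))).const_mul (‖a - c‖ ^ 2)⁻¹
    convert h using 2
    simp only [norm_zero]
    ring

/-- The fundamental theorem of calculus in place of residues: each end of the line contributes at
most `4π |a - c|⁻³`. -/
theorem norm_integral_inv_sq_mul_inv_sq_le {a c : ℂ} (ha : a.im ≠ 0) (hc : c.im ≠ 0)
    (hac : a ≠ c) : ‖∫ x : ℝ, (((x : ℂ) - a) ^ 2)⁻¹ * (((x : ℂ) - c) ^ 2)⁻¹‖ ≤
      8 * Real.pi * (‖a - c‖ ^ 3)⁻¹ := by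
  have hlim := (intervalIntegral_tendsto_integral (integrable_inv_sq_mul_inv_sq ha hc)
    Filter.tendsto_neg_atTop_atBot Filter.tendsto_id).norm
  obtain ⟨B, hB, hBlim⟩ := exists_tendsto_norm_invSqPrimitive_le ha hc
    Filter.tendsto_abs_atTop_atTop
  obtain ⟨B', hB', hBlim'⟩ := exists_tendsto_norm_invSqPrimitive_le ha hc
    Filter.tendsto_abs_atBot_atTop
  have hsum := hBlim.add (hBlim'.comp Filter.tendsto_neg_atTop_atBot)
  have key := le_of_tendsto_of_tendsto' hlim hsum fun R => ?_
  · refine key.trans_eq ?_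
    ring
  · rw [intervalIntegral.integral_eq_sub_of_hasDerivAt
      (fun x _ => hasDerivAt_invSqPrimitive ha hc hac x)
      (integrable_inv_sq_mul_inv_sq ha hc).intervalIntegrable]
    exact (norm_sub_le _ _).trans (add_le_add (hB _) (hB' _))

/-- Conjugation moves the second pole across the line, so the imaginary parts add up and `|w - conj
w'|` is at least `|Im w| + |Im w'|`. One factor of the cube is replaced by this lower bound. -/
theorem norm_integral_inv_sq_mul_inv_sq_conj_le {w w' : ℂ} (h : 0 < w.im * w'.im) :
    ‖∫ x : ℝ, (((x : ℂ) - w) ^ 2)⁻¹ * (((x : ℂ) - (starRingEnd ℂ) w') ^ 2)⁻¹‖ ≤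
      8 * Real.pi * cubicKernel w w' := by
  have hw : w.im ≠ 0 := left_ne_zero_of_mul h.ne'
  have hw' : w'.im ≠ 0 := right_ne_zero_of_mul h.ne'
  have him : (w - (starRingEnd ℂ) w').im = w.im + w'.im := by simp
  have hre : (w - (starRingEnd ℂ) w').re = w.re - w'.re := by simp
  have habs : |w.im + w'.im| = |w.im| + |w'.im| := by
    rw [abs_add_eq_add_abs_iff]
    rcases pos_and_pos_or_neg_and_neg_of_mul_pos h with ⟨h1, h2⟩ | ⟨h1, h2⟩
    · exact Or.inl ⟨h1.le, h2.le⟩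
    · exact Or.inr ⟨h1.le, h2.le⟩
  have ht : 0 < |w.im| + |w'.im| := by positivity
  have hne : w ≠ (starRingEnd ℂ) w' := fun he => by
    rw [sub_eq_zero.2 he, Complex.zero_im] at him
    rw [← him, abs_zero] at habs
    exact ht.ne habs
  refine (norm_integral_inv_sq_mul_inv_sq_le hw (by simpa using hw') hne).trans ?_
  have hsq : ‖w - (starRingEnd ℂ) w'‖ ^ 2 =
      (w'.re - w.re) ^ 2 + (|w.im| + |w'.im|) ^ 2 := by
    rw [Complex.sq_norm, Complex.normSq_apply, him, hre, ← habs, sq_abs]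
    ring
  have hle : |w.im| + |w'.im| ≤ ‖w - (starRingEnd ℂ) w'‖ := by
    rw [← habs, ← him]
    exact Complex.abs_im_le_norm _
  have hpos := ht.trans_le hle
  rw [cubicKernel, ← hsq, ← mul_inv, pow_succ' _ 2]
  gcongr

/-! ### The square function estimate -/

/-- The function `x ↦ ∫ g(w) / (x - w)² dm(w)` on the real line. -/
noncomputable def cauchySq (g : ℂ → ℂ) (x : ℝ) : ℂ := ∫ w, g w * (((x : ℂ) - w) ^ 2)⁻¹

theorem measurable_cauchySq {g : ℂ → ℂ} (hg : Measurable g) : Measurable (cauchySq g) := by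
  refine (StronglyMeasurable.integral_prod_right' (ν := (volume : Measure ℂ))
    (f := fun p : ℝ × ℂ => g p.2 * (((p.1 : ℂ) - p.2) ^ 2)⁻¹) ?_).measurable
  exact Measurable.stronglyMeasurable (by fun_prop)

/-- The integrand in the expansion of `‖cauchySq g x‖²` as a double integral. -/
noncomputable def cauchySqPair (g : ℂ → ℂ) (x : ℝ) (p : ℂ × ℂ) : ℂ :=
  g p.1 * (starRingEnd ℂ) (g p.2) *
    ((((x : ℂ) - p.1) ^ 2)⁻¹ * (((x : ℂ) - (starRingEnd ℂ) p.2) ^ 2)⁻¹)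

theorem integral_cauchySqPair (g : ℂ → ℂ) (x : ℝ) :
    ∫ p, cauchySqPair g x p = ((‖cauchySq g x‖ ^ 2 : ℝ) : ℂ) := by
  have h : ∀ p : ℂ × ℂ, cauchySqPair g x p = (g p.1 * (((x : ℂ) - p.1) ^ 2)⁻¹) *
      (starRingEnd ℂ) (g p.2 * (((x : ℂ) - p.2) ^ 2)⁻¹) := by
    intro p
    simp only [cauchySqPair, map_mul, map_inv₀, map_pow, map_sub, Complex.conj_ofReal]
    ring
  simp_rw [h]
  rw [Measure.volume_eq_prod,
    integral_prod_mul (fun w => g w * (((x : ℂ) - w) ^ 2)⁻¹)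
      (fun w => (starRingEnd ℂ) (g w * (((x : ℂ) - w) ^ 2)⁻¹)), integral_conj, ← cauchySq, Complex.mul_conj,
    Complex.normSq_eq_norm_sq]

section

variable {g : ℂ → ℂ} {δ : ℝ}

theorem measurable_cauchySqPair (hg : Measurable g) :
    Measurable (Function.uncurry (cauchySqPair g)) := by
  simp only [Function.uncurry_def, cauchySqPair]
  have hc : Measurable (starRingEnd ℂ : ℂ → ℂ) := Complex.continuous_conj.measurable
  have h1 : Measurable fun p : ℝ × ℂ × ℂ => (starRingEnd ℂ) (g p.2.2) := hc.comp (by fun_prop)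
  have h2 : Measurable fun p : ℝ × ℂ × ℂ => (starRingEnd ℂ) p.2.2 := hc.comp (by fun_prop)
  fun_prop

/-- A bound that degenerates as `δ → 0`; it serves only to justify Fubini and leaves no trace in the
final estimate. -/
theorem lintegral_enorm_cauchySqPair_le (hδ : 0 < δ) (hgδ : ∀ w, g w ≠ 0 → δ ≤ |w.im|)
    (p : ℂ × ℂ) : ∫⁻ x : ℝ, ‖cauchySqPair g x p‖ₑ ≤
      ‖g p.1‖ₑ * ‖g p.2‖ₑ * ENNReal.ofReal (Real.pi / δ * (δ ^ 2)⁻¹) := by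
  by_cases h1 : g p.1 = 0
  · simp [cauchySqPair, h1]
  by_cases h2 : g p.2 = 0
  · simp [cauchySqPair, h2]
  have hi1 := hgδ _ h1
  have hi2 := hgδ _ h2
  have hconj : δ ≤ |((starRingEnd ℂ) p.2).im| := by simpa using hi2
  calc ∫⁻ x : ℝ, ‖cauchySqPair g x p‖ₑ
      ≤ ∫⁻ x : ℝ, ‖g p.1‖ₑ * ‖g p.2‖ₑ * (ENNReal.ofReal ((x - p.1.re) ^ 2 + |p.1.im| ^ 2)⁻¹ *
          ENNReal.ofReal (δ ^ 2)⁻¹) := by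
        refine lintegral_mono fun x => ?_
        simp only [cauchySqPair]
        rw [enorm_mul, enorm_mul, RCLike.enorm_conj, ← ENNReal.ofReal_mul (by positivity)]
        gcongr
        rw [← ofReal_norm]
        exact ENNReal.ofReal_le_ofReal (norm_inv_sq_mul_inv_sq_le hδ hconj x)
    _ = ‖g p.1‖ₑ * ‖g p.2‖ₑ * (ENNReal.ofReal (Real.pi / |p.1.im|) *
          ENNReal.ofReal (δ ^ 2)⁻¹) := by
        rw [lintegral_const_mul _ (by fun_prop), lintegral_mul_const _ (by fun_prop),
          lintegral_inv_sub_sq_add_sq _ (hδ.trans_le hi1)]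
    _ ≤ _ := by
        rw [ENNReal.ofReal_mul (by positivity)]
        gcongr

theorem integrable_cauchySqPair (hg : Measurable g) (hgi : Integrable g) (hδ : 0 < δ)
    (hgδ : ∀ w, g w ≠ 0 → δ ≤ |w.im|) :
    Integrable (Function.uncurry (cauchySqPair g))
      ((volume : Measure ℝ).prod (volume : Measure (ℂ × ℂ))) := by
  refine ⟨(measurable_cauchySqPair hg).aestronglyMeasurable, ?_⟩
  rw [HasFiniteIntegral, lintegral_prod_symm' _ (measurable_cauchySqPair hg).enorm]
  refine (lintegral_mono fun p => lintegral_enorm_cauchySqPair_le hδ hgδ p).trans_lt ?_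
  rw [lintegral_mul_const _ (by fun_prop), Measure.volume_eq_prod,
    lintegral_prod_mul hg.enorm.aemeasurable hg.enorm.aemeasurable]
  exact ENNReal.mul_lt_top (ENNReal.mul_lt_top hgi.2 hgi.2) ENNReal.ofReal_lt_top

theorem enorm_integral_cauchySqPair_le (hsgn : ∀ w w', g w ≠ 0 → g w' ≠ 0 → 0 < w.im * w'.im)
    (p : ℂ × ℂ) : ‖∫ x : ℝ, cauchySqPair g x p‖ₑ ≤
      ‖g p.1‖ₑ * ‖g p.2‖ₑ * ENNReal.ofReal (8 * Real.pi * cubicKernel p.1 p.2) := by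
  by_cases h1 : g p.1 = 0
  · simp [cauchySqPair, h1]
  by_cases h2 : g p.2 = 0
  · simp [cauchySqPair, h2]
  simp only [cauchySqPair]
  rw [integral_const_mul, enorm_mul, enorm_mul, RCLike.enorm_conj]
  gcongr
  rw [← ofReal_norm]
  exact ENNReal.ofReal_le_ofReal (norm_integral_inv_sq_mul_inv_sq_conj_le (hsgn _ _ h1 h2))

theorem lintegral_sq_mul_cubicKernel_le (hg : Measurable g) (h0 : ∀ w, g w ≠ 0 → w.im ≠ 0) :
    ∫⁻ w, ∫⁻ w', ‖g w‖ₑ ^ 2 * ENNReal.ofReal (8 * Real.pi * cubicKernel w w') ≤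
      ENNReal.ofReal (8 * Real.pi ^ 3) * ∫⁻ w, ‖g w‖ₑ ^ 2 / ENNReal.ofReal |w.im| := by
  rw [← lintegral_const_mul]
  swap
  · exact (hg.enorm.pow_const 2).div Complex.measurable_im.abs.ennreal_ofReal
  refine lintegral_mono fun w => ?_
  by_cases hw : g w = 0
  · simp [hw]
  have hk : Measurable fun w' => ENNReal.ofReal (cubicKernel w w') :=
    (measurable_cubicKernel.comp measurable_prodMk_left).ennreal_ofReal
  have him : 0 < |w.im| := abs_pos.2 (h0 w hw)
  simp_rw [ENNReal.ofReal_mul (by positivity : 0 ≤ 8 * Real.pi)]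
  rw [lintegral_const_mul _ (hk.const_mul _), lintegral_const_mul _ hk]
  calc _ ≤ ‖g w‖ₑ ^ 2 * (ENNReal.ofReal (8 * Real.pi) *
        ENNReal.ofReal (Real.pi ^ 2 / |w.im|)) := by
        gcongr
        exact lintegral_cubicKernel_le (h0 w hw)
    _ = _ := by
        rw [ENNReal.div_eq_inv_mul, ← ENNReal.ofReal_inv_of_pos him,
          mul_comm (ENNReal.ofReal _) (_ ^ 2), mul_left_comm (ENNReal.ofReal (8 * Real.pi ^ 3)),
          ← ENNReal.ofReal_mul (by positivity), ← ENNReal.ofReal_mul (by positivity)]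
        congr 2
        ring

/-- A square function estimate: if `g` lives in one of the half planes, then `cauchySq g` is
controlled in `L²(ℝ)` by `g` in `L²(dm / |y|)`. -/
theorem lintegral_cauchySq_sq_le (hg : Measurable g) (hgi : Integrable g) (hδ : 0 < δ)
    (hgδ : ∀ w, g w ≠ 0 → δ ≤ |w.im|)
    (hsgn : ∀ w w', g w ≠ 0 → g w' ≠ 0 → 0 < w.im * w'.im) :
    ∫⁻ x, ‖cauchySq g x‖ₑ ^ 2 ≤
      ENNReal.ofReal (16 * Real.pi ^ 3) * ∫⁻ w, ‖g w‖ₑ ^ 2 / ENNReal.ofReal |w.im| := by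
  have hint := integrable_cauchySqPair hg hgi hδ hgδ
  have hsq : Integrable fun x => ‖cauchySq g x‖ ^ 2 := by
    have := hint.integral_prod_left
    simp only [Function.uncurry, integral_cauchySqPair] at this
    exact this.re
  have h0 : ∀ w, g w ≠ 0 → w.im ≠ 0 := fun w hw => abs_pos.1 (hδ.trans_le (hgδ w hw))
  calc ∫⁻ x, ‖cauchySq g x‖ₑ ^ 2 = ENNReal.ofReal (∫ x, ‖cauchySq g x‖ ^ 2) := by
        rw [ofReal_integral_eq_lintegral_ofReal hsq
          (Filter.Eventually.of_forall fun x => by positivity)]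
        refine lintegral_congr fun x => ?_
        rw [ENNReal.ofReal_pow (norm_nonneg _), ofReal_norm]
    _ = ‖∫ x, ∫ p, cauchySqPair g x p‖ₑ := by
        simp_rw [integral_cauchySqPair]
        rw [integral_complex_ofReal, ← ofReal_norm, Complex.norm_real, Real.norm_of_nonneg
          (integral_nonneg fun x => by positivity)]
    -- The `x`-integral must precede the absolute values: with them inside, the kernel would carry a
    -- factor `1 / (|Im w| |Im w'|)`, not integrable near the line.
    _ = ‖∫ p, ∫ x, cauchySqPair g x p‖ₑ := by rw [integral_integral_swap hint]
    _ ≤ ∫⁻ p : ℂ × ℂ, ‖∫ x, cauchySqPair g x p‖ₑ := enorm_integral_le_lintegral_enorm _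
    _ ≤ ∫⁻ p : ℂ × ℂ, (‖g p.1‖ₑ ^ 2 * ENNReal.ofReal (8 * Real.pi * cubicKernel p.1 p.2) +
          ‖g p.2‖ₑ ^ 2 * ENNReal.ofReal (8 * Real.pi * cubicKernel p.1 p.2)) := by
        refine lintegral_mono fun p => (enorm_integral_cauchySqPair_le hsgn p).trans ?_
        rw [← add_mul]
        gcongr
        -- The product is at most the larger square, hence at most the sum of both. By symmetry of
        -- the kernel the two sums agree, which doubles `8π³` to `16π³`.
        rcases le_total ‖g p.1‖ₑ ‖g p.2‖ₑ with h | h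
        · exact (mul_le_mul_left h _).trans (by rw [← sq]; exact le_add_self)
        · exact (mul_le_mul_right h _).trans (by rw [← sq]; exact le_self_add)
    _ = (∫⁻ w, ∫⁻ w', ‖g w‖ₑ ^ 2 * ENNReal.ofReal (8 * Real.pi * cubicKernel w w')) +
          ∫⁻ w, ∫⁻ w', ‖g w‖ₑ ^ 2 * ENNReal.ofReal (8 * Real.pi * cubicKernel w w') := by
        have hm : Measurable fun p : ℂ × ℂ => ENNReal.ofReal (8 * Real.pi * cubicKernel p.1 p.2) :=
          (measurable_cubicKernel.const_mul _).ennreal_ofReal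
        rw [lintegral_add_left (by fun_prop), Measure.volume_eq_prod,
          lintegral_prod _ (by fun_prop), lintegral_prod_symm _ (by fun_prop)]
        simp only [fun w w' => cubicKernel_comm w' w]
    _ ≤ _ := by
        have h := lintegral_sq_mul_cubicKernel_le hg h0
        refine (add_le_add h h).trans_eq ?_
        rw [← add_mul, ← ENNReal.ofReal_add (by positivity) (by positivity)]
        congr 2
        ring

end

/-! ### Linear operations on L² primitive limits -/

namespace IsL2PrimitiveLimit

variable {f f' : ℝ → ℂ} {a b : ℝ} {F F' T T' : ℕ → ℝ → ℂ} {M M' : ENNReal}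

theorem congr (h : IsL2PrimitiveLimit f a b F T M) (hf : ∀ x ∈ Set.Icc a b, f' x = f x) :
    IsL2PrimitiveLimit f' a b F T M :=
  { h with tendsto := fun x hx => by rw [hf x hx]; exact h.tendsto x hx }

theorem intervalIntegrable (h : IsL2PrimitiveLimit f a b F T M) (n : ℕ) {c d : ℝ}
    (hc : c ∈ Set.Icc a b) (hd : d ∈ Set.Icc a b) : IntervalIntegrable (T n) volume c d := by
  have hmem : MemLp (T n) 2 (volume.restrict (Set.Icc a b)) := by
    refine ⟨(h.measurable n).aestronglyMeasurable, ?_⟩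
    rw [eLpNorm_lt_top_iff_lintegral_rpow_enorm_lt_top two_ne_zero ENNReal.ofNat_ne_top]
    simp only [ENNReal.toReal_ofNat, ENNReal.rpow_two]
    exact (h.bound n).trans_lt h.lt_top
  rw [intervalIntegrable_iff]
  exact (hmem.integrable one_le_two).mono_measure
    (Measure.restrict_mono (uIoc_subset hc hd) le_rfl)

theorem add (h : IsL2PrimitiveLimit f a b F T M) (h' : IsL2PrimitiveLimit f' a b F' T' M') :
    IsL2PrimitiveLimit (fun x => f x + f' x) a b (fun n x => F n x + F' n x)
      (fun n x => T n x + T' n x) (2 * (M + M')) where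
  tendsto x hx := (h.tendsto x hx).add (h'.tendsto x hx)
  sub_eq n c hc d hd := by
    rw [intervalIntegral.integral_add (h.intervalIntegrable n hc hd)
      (h'.intervalIntegrable n hc hd), ← h.sub_eq n c hc d hd, ← h'.sub_eq n c hc d hd]
    ring
  measurable n := (h.measurable n).add (h'.measurable n)
  bound n := by
    calc ∫⁻ t in Set.Icc a b, ‖T n t + T' n t‖ₑ ^ 2
        ≤ ∫⁻ t in Set.Icc a b, 2 * (‖T n t‖ₑ ^ 2 + ‖T' n t‖ₑ ^ 2) := by
          refine lintegral_mono fun t => ?_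
          have h1 := ENNReal.rpow_add_le_mul_rpow_add_rpow ‖T n t‖ₑ ‖T' n t‖ₑ one_le_two
          norm_num at h1
          exact (pow_le_pow_left' (enorm_add_le _ _) 2).trans h1
      _ = 2 * ((∫⁻ t in Set.Icc a b, ‖T n t‖ₑ ^ 2) + ∫⁻ t in Set.Icc a b, ‖T' n t‖ₑ ^ 2) := by
          have hT := h.measurable n
          have hT' := h'.measurable n
          rw [lintegral_const_mul _ (by fun_prop), lintegral_add_left (by fun_prop)]
      _ ≤ _ := by
          gcongr
          exacts [h.bound n, h'.bound n]
  lt_top := ENNReal.mul_lt_top ENNReal.ofNat_lt_top (ENNReal.add_lt_top.2 ⟨h.lt_top, h'.lt_top⟩)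

theorem const_mul (h : IsL2PrimitiveLimit f a b F T M) (κ : ℂ) :
    IsL2PrimitiveLimit (fun x => κ * f x) a b (fun n x => κ * F n x)
      (fun n x => κ * T n x) (‖κ‖ₑ ^ 2 * M) where
  tendsto x hx := (h.tendsto x hx).const_mul κ
  sub_eq n c hc d hd := by
    rw [intervalIntegral.integral_const_mul, ← h.sub_eq n c hc d hd, mul_sub]
  measurable n := (h.measurable n).const_mul κ
  bound n := by
    simp_rw [enorm_mul, mul_pow]
    rw [lintegral_const_mul _ ((h.measurable n).enorm.pow_const 2)]
    gcongr
    exact h.bound n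
  lt_top := ENNReal.mul_lt_top (ENNReal.pow_lt_top enorm_lt_top) h.lt_top

end IsL2PrimitiveLimit

/-! ### Cauchy integrals on the line as L² primitive limits -/

/-- The Cauchy type integral `x ↦ ∫ g(w) / (x - w) dm(w)` on the real line. -/
noncomputable def cauchyInt (g : ℂ → ℂ) (x : ℝ) : ℂ := ∫ w, g w * ((x : ℂ) - w)⁻¹

section

variable {g : ℂ → ℂ} {a b δ : ℝ}

theorem norm_mul_inv_pow_le (hδ : 0 < δ) {x : ℝ} (hx : ∀ w, g w ≠ 0 → δ ≤ ‖(x : ℂ) - w‖)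
    (m : ℕ) (w : ℂ) : ‖g w * (((x : ℂ) - w) ^ m)⁻¹‖ ≤ ‖g w‖ * (δ ^ m)⁻¹ := by
  by_cases hw : g w = 0
  · simp [hw]
  rw [norm_mul, norm_inv, norm_pow]
  gcongr
  exact hx w hw

theorem integrable_mul_inv (hg : Measurable g) (hgi : Integrable g) (hδ : 0 < δ) {x : ℝ}
    (hx : ∀ w, g w ≠ 0 → δ ≤ ‖(x : ℂ) - w‖) : Integrable fun w => g w * ((x : ℂ) - w)⁻¹ := by
  refine (hgi.norm.mul_const (δ ^ 1)⁻¹).mono' (Measurable.aestronglyMeasurable (by fun_prop))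
    (Filter.Eventually.of_forall fun w => ?_)
  simpa using norm_mul_inv_pow_le hδ hx 1 w

theorem integral_mul_inv_sq_eq (hδ : 0 < δ)
    (hsep : ∀ x ∈ Set.Icc a b, ∀ w, g w ≠ 0 → δ ≤ ‖(x : ℂ) - w‖) {c d : ℝ}
    (hc : c ∈ Set.Icc a b) (hd : d ∈ Set.Icc a b) (w : ℂ) :
    ∫ t in c..d, g w * (((t : ℂ) - w) ^ 2)⁻¹ =
      g w * ((c : ℂ) - w)⁻¹ - g w * ((d : ℂ) - w)⁻¹ := by
  by_cases hw : g w = 0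
  · simp [hw]
  have hne : ∀ t ∈ Set.uIcc c d, (t : ℂ) - w ≠ 0 := fun t ht =>
    norm_pos_iff.1 (hδ.trans_le (hsep t (Set.uIcc_subset_Icc hc hd ht) w hw))
  rw [intervalIntegral.integral_const_mul, ← mul_sub]
  congr 1
  have hderiv : ∀ t ∈ Set.uIcc c d,
      HasDerivAt (fun t : ℝ => -((t : ℂ) - w)⁻¹) ((((t : ℂ) - w) ^ 2)⁻¹) t := by
    intro t ht
    have h1 : HasDerivAt (fun x : ℝ => (x : ℂ) - w) 1 t :=
      (Complex.ofRealCLM.hasDerivAt (x := t)).sub_const w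
    refine (h1.fun_inv (hne t ht)).fun_neg.congr_deriv ?_
    rw [neg_div, neg_neg, one_div]
  rw [intervalIntegral.integral_eq_sub_of_hasDerivAt hderiv]
  · ring
  · refine ContinuousOn.intervalIntegrable ?_
    exact ContinuousOn.inv₀ (by fun_prop) fun t ht => pow_ne_zero 2 (hne t ht)

/-- Fubini for the `x`-derivative of the kernel, which the separation bounds by `δ⁻²` on the support
of `g`. -/
theorem cauchyInt_sub_eq (hg : Measurable g) (hgi : Integrable g) (hδ : 0 < δ)
    (hsep : ∀ x ∈ Set.Icc a b, ∀ w, g w ≠ 0 → δ ≤ ‖(x : ℂ) - w‖) {c d : ℝ}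
    (hc : c ∈ Set.Icc a b) (hd : d ∈ Set.Icc a b) :
    cauchyInt g d - cauchyInt g c = ∫ t in c..d, -cauchySq g t := by
  have hint : Integrable (Function.uncurry fun (t : ℝ) (w : ℂ) => g w * (((t : ℂ) - w) ^ 2)⁻¹)
      ((volume.restrict (Set.uIoc c d)).prod volume) := by
    have hfin : IsFiniteMeasure (volume.restrict (Set.uIoc c d)) :=
      ⟨by simp [Real.volume_uIoc]⟩
    have hdom : Integrable (fun p : ℝ × ℂ => (1 : ℝ) * (‖g p.2‖ * (δ ^ 2)⁻¹))
        ((volume.restrict (Set.uIoc c d)).prod volume) :=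
      (integrable_const (1 : ℝ)).mul_prod (hgi.norm.mul_const _)
    refine hdom.mono' ?_ ?_
    · refine Measurable.aestronglyMeasurable ?_
      simp only [Function.uncurry_def]
      fun_prop
    · have hae : ∀ᵐ p : ℝ × ℂ ∂((volume.restrict (Set.uIoc c d)).prod volume),
          p.1 ∈ Set.uIoc c d :=
        Measure.quasiMeasurePreserving_fst.ae (ae_restrict_mem measurableSet_uIoc)
      filter_upwards [hae] with p hp
      rw [one_mul]
      exact norm_mul_inv_pow_le hδ (hsep p.1 (IsL2PrimitiveLimit.uIoc_subset hc hd hp)) 2 p.2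
  rw [intervalIntegral.integral_neg]
  simp only [cauchySq]
  rw [intervalIntegral_integral_swap hint]
  simp_rw [integral_mul_inv_sq_eq hδ hsep hc hd]
  rw [integral_sub (integrable_mul_inv hg hgi hδ (hsep c hc))
    (integrable_mul_inv hg hgi hδ (hsep d hd)), neg_sub]
  rfl

/-- No approximation is needed away from the support: the constant sequence works, with a pointwise
bounded derivative. -/
theorem isL2PrimitiveLimit_cauchyInt_of_separated (hg : Measurable g) (hgi : Integrable g)
    (hδ : 0 < δ) (hsep : ∀ x ∈ Set.Icc a b, ∀ w, g w ≠ 0 → δ ≤ ‖(x : ℂ) - w‖) :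
    IsL2PrimitiveLimit (cauchyInt g) a b (fun _ => cauchyInt g) (fun _ x => -cauchySq g x)
      (ENNReal.ofReal ((∫ w, ‖g w‖ * (δ ^ 2)⁻¹) ^ 2) * volume (Set.Icc a b)) where
  tendsto x _ := tendsto_const_nhds
  sub_eq _ c hc d hd := cauchyInt_sub_eq hg hgi hδ hsep hc hd
  measurable _ := (measurable_cauchySq hg).neg
  bound _ := by
    rw [← setLIntegral_const]
    refine setLIntegral_mono' measurableSet_Icc fun x hx => ?_
    rw [enorm_neg, ← ofReal_norm, ← ENNReal.ofReal_pow (norm_nonneg _)]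
    refine ENNReal.ofReal_le_ofReal (pow_le_pow_left₀ (norm_nonneg _) ?_ 2)
    exact norm_integral_le_of_norm_le (hgi.norm.mul_const _)
      (Filter.Eventually.of_forall (norm_mul_inv_pow_le hδ (hsep x hx) 2))
  lt_top := ENNReal.mul_lt_top ENNReal.ofReal_lt_top (by simp)

/-- On each horizontal line of height `y ≠ 0` the integral is exactly `π`, so it is finite over a
bounded strip. This is the dual quantity to the weight `1 / |y|`. -/
theorem lintegral_im_mul_inv_lt_top (x L : ℝ) :
    ∫⁻ w : ℂ, ENNReal.ofReal
      ((Set.Icc (-L) L).indicator (fun y => |y|) w.im * ((w.re - x) ^ 2 + |w.im| ^ 2)⁻¹) < ⊤ := by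
  have hind : Measurable ((Set.Icc (-L) L).indicator fun y : ℝ => |y|) :=
    measurable_id.abs.indicator measurableSet_Icc
  have him : Measurable fun w : ℂ => |w.im| := Complex.measurable_im.abs
  rw [lintegral_complex_eq
    (F := fun w : ℂ => ENNReal.ofReal
      ((Set.Icc (-L) L).indicator (fun y => |y|) w.im * ((w.re - x) ^ 2 + |w.im| ^ 2)⁻¹))]
  swap
  · exact ((hind.comp Complex.measurable_im).mul (((Complex.measurable_re.sub_const x).pow_const
      2).add (him.pow_const 2)).inv).ennreal_ofReal
  calc _ ≤ ∫⁻ y : ℝ, (Set.Icc (-L) L).indicator (fun _ => ENNReal.ofReal Real.pi) y := by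
        refine lintegral_mono fun y => ?_
        by_cases hy : y ∈ Set.Icc (-L) L
        · simp only [Set.indicator_of_mem hy]
          rcases eq_or_ne y 0 with rfl | h0
          · simp
          have hpos := abs_pos.2 h0
          simp_rw [ENNReal.ofReal_mul (abs_nonneg y)]
          rw [lintegral_const_mul _ (by fun_prop), lintegral_inv_sub_sq_add_sq x hpos,
            ← ENNReal.ofReal_mul (abs_nonneg y), mul_div_cancel₀ _ hpos.ne']
        · simp [Set.indicator_of_notMem hy]
    _ < ⊤ := by
        rw [lintegral_indicator measurableSet_Icc, setLIntegral_const]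
        exact ENNReal.mul_lt_top ENNReal.ofReal_lt_top (by simp)

/-- By the arithmetic–geometric inequality, `|g| / |x - w| ≤ |g|² / |y| + |y| / |x - w|²`. This
gives absolute convergence at every real `x`, not merely almost every one. -/
theorem integrable_mul_inv_of_weighted (hg : Measurable g) (h0 : ∀ w, g w ≠ 0 → w.im ≠ 0) {L : ℝ}
    (hL : ∀ w, g w ≠ 0 → |w.im| ≤ L)
    (hfin : ∫⁻ w, ‖g w‖ₑ ^ 2 / ENNReal.ofReal |w.im| < ⊤) (x : ℝ) :
    Integrable fun w => g w * ((x : ℂ) - w)⁻¹ := by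
  refine ⟨Measurable.aestronglyMeasurable (by fun_prop), ?_⟩
  have hm : Measurable fun w => ‖g w‖ₑ ^ 2 / ENNReal.ofReal |w.im| :=
    (hg.enorm.pow_const 2).div Complex.measurable_im.abs.ennreal_ofReal
  refine lt_of_le_of_lt (lintegral_mono fun w => ?_) ((lintegral_add_left hm _).trans_lt
    (ENNReal.add_lt_top.2 ⟨hfin, lintegral_im_mul_inv_lt_top x L⟩))
  by_cases hw : g w = 0
  · simp [hw]
  have hy : 0 < |w.im| := abs_pos.2 (h0 w hw)
  have hr : ‖(x : ℂ) - w‖ ^ 2 = (w.re - x) ^ 2 + |w.im| ^ 2 := by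
    rw [sq_norm_ofReal_sub]; ring
  have hr0 : 0 < ‖(x : ℂ) - w‖ := norm_pos_iff.2 (ofReal_sub_ne_zero (h0 w hw) x)
  have hmem : w.im ∈ Set.Icc (-L) L := abs_le.1 (hL w hw)
  rw [Set.indicator_of_mem hmem, ← hr, ← ofReal_norm, ← ofReal_norm,
    ← ENNReal.ofReal_pow (norm_nonneg _), ← ENNReal.ofReal_div_of_pos hy,
    ← ENNReal.ofReal_add (by positivity) (by positivity), norm_mul, norm_inv]
  refine ENNReal.ofReal_le_ofReal ?_
  rw [div_add' _ _ _ hy.ne', ← div_eq_mul_inv, div_le_div_iff₀ hr0 hy]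
  field_simp
  nlinarith [sq_nonneg (‖g w‖ * ‖(x : ℂ) - w‖ - |w.im|), mul_pos hr0 hy, norm_nonneg (g w),
    mul_nonneg (mul_nonneg (norm_nonneg (g w)) hr0.le) hy.le]

theorem isL2PrimitiveLimit_cauchyInt_of_weighted (hg : Measurable g) (hgi : Integrable g)
    (hsgn : ∀ w w', g w ≠ 0 → g w' ≠ 0 → 0 < w.im * w'.im) {L : ℝ}
    (hL : ∀ w, g w ≠ 0 → |w.im| ≤ L)
    (hfin : ∫⁻ w, ‖g w‖ₑ ^ 2 / ENNReal.ofReal |w.im| < ⊤) (a b : ℝ) :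
    ∃ F T M, IsL2PrimitiveLimit (cauchyInt g) a b F T M := by
  have h0 : ∀ w, g w ≠ 0 → w.im ≠ 0 := fun w hw => left_ne_zero_of_mul (hsgn w w hw hw).ne'
  -- Truncation away from the real line: each `G n` is separated from it, while the square function
  -- bound does not see the distance.
  set S : ℕ → Set ℂ := fun n => {w | 1 / ((n : ℝ) + 1) ≤ |w.im|} with hS
  have hSm : ∀ n, MeasurableSet (S n) := fun n =>
    measurableSet_le measurable_const Complex.measurable_im.abs
  set G : ℕ → ℂ → ℂ := fun n => (S n).indicator g with hG
  have hGm : ∀ n, Measurable (G n) := fun n => hg.indicator (hSm n)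
  have hGi : ∀ n, Integrable (G n) := fun n => hgi.indicator (hSm n)
  have hGmem : ∀ n w, G n w ≠ 0 → w ∈ S n ∧ g w ≠ 0 := fun n w hw => by
    simpa [hG] using hw
  have hsep : ∀ n, ∀ x ∈ Set.Icc a b, ∀ w, G n w ≠ 0 → 1 / ((n : ℝ) + 1) ≤ ‖(x : ℂ) - w‖ :=
    fun n x _ w hw => (hGmem n w hw).1.trans (abs_im_le_norm_ofReal_sub x w)
  have hGle : ∀ n w, ‖G n w‖ ≤ ‖g w‖ := fun n w => norm_indicator_le_norm_self _ _
  refine ⟨fun n => cauchyInt (G n), fun n x => -cauchySq (G n) x,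
    ENNReal.ofReal (16 * Real.pi ^ 3) * ∫⁻ w, ‖g w‖ₑ ^ 2 / ENNReal.ofReal |w.im|,
    fun x _ => ?_, fun n c hc d hd => ?_, fun n => ?_, fun n => ?_, ?_⟩
  · have hdom := integrable_mul_inv_of_weighted hg h0 hL hfin x
    refine tendsto_integral_of_dominated_convergence _
      (fun n => Measurable.aestronglyMeasurable (by have := hGm n; fun_prop)) hdom.norm
      (fun n => Filter.Eventually.of_forall fun w => ?_) (Filter.Eventually.of_forall fun w => ?_)
    · rw [norm_mul, norm_mul]
      gcongr
      exact hGle n w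
    · refine Filter.Tendsto.mul_const _ ?_
      by_cases hw : g w = 0
      · have : ∀ n, G n w = g w := fun n => by simp [hG, Set.indicator_apply, hw]
        simp_rw [this]
        exact tendsto_const_nhds
      · refine tendsto_const_nhds.congr' ?_
        filter_upwards [tendsto_one_div_add_atTop_nhds_zero_nat.eventually_lt_const
          (abs_pos.2 (h0 w hw))] with n hn
        exact (Set.indicator_of_mem (show w ∈ S n from hn.le) g).symm
  · exact cauchyInt_sub_eq (hGm n) (hGi n) Nat.one_div_pos_of_nat (hsep n) hc hd
  · exact (measurable_cauchySq (hGm n)).neg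
  · simp_rw [enorm_neg]
    refine (setLIntegral_le_lintegral _ _).trans ((lintegral_cauchySq_sq_le (hGm n) (hGi n)
      Nat.one_div_pos_of_nat (fun w hw => (hGmem n w hw).1)
      fun w w' hw hw' => hsgn w w' (hGmem n w hw).2 (hGmem n w' hw').2).trans ?_)
    gcongr with w
    exact enorm_le_iff_norm_le.2 (hGle n w)
  · exact ENNReal.mul_lt_top ENNReal.ofReal_lt_top hfin

end

/-! ### Weak ∂̄-derivatives and the Cauchy–Pompeiu formula -/

/-- The Wirtinger derivative `∂̄φ = (φ_x + i φ_y) / 2`. -/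
noncomputable def dbar (φ : ℂ → ℂ) (w : ℂ) : ℂ :=
  (fderiv ℝ φ w 1 + Complex.I * fderiv ℝ φ w Complex.I) / 2

theorem continuous_dbar {φ : ℂ → ℂ} (hφ : ContDiff ℝ ∞ φ) : Continuous (dbar φ) := by
  have h := hφ.continuous_fderiv (by simp)
  unfold dbar
  fun_prop

theorem dbar_mul {φ ψ : ℂ → ℂ} {w : ℂ} (hφ : DifferentiableAt ℝ φ w)
    (hψ : DifferentiableAt ℝ ψ w) :
    dbar (fun w => φ w * ψ w) w = dbar φ w * ψ w + φ w * dbar ψ w := by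
  simp only [dbar]
  rw [fderiv_fun_mul hφ hψ]
  simp only [add_apply, smul_apply, smul_eq_mul]
  ring

theorem dbar_eq_zero_of_notMem_tsupport {φ : ℂ → ℂ} {w : ℂ} (hw : w ∉ tsupport φ) :
    dbar φ w = 0 := by
  simp [dbar, fderiv_of_notMem_tsupport ℝ hw]

theorem hasCompactSupport_dbar {φ : ℂ → ℂ} (hφ : HasCompactSupport φ) :
    HasCompactSupport (dbar φ) :=
  HasCompactSupport.intro hφ fun _ hw => dbar_eq_zero_of_notMem_tsupport hw

theorem integrable_mul_of_hasCompactSupport {f φ : ℂ → ℂ} (hf : LocallyIntegrable f)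
    (hφ : Continuous φ) (hs : HasCompactSupport φ) : Integrable fun w => f w * φ w :=
  hf.integrable_smul_right_of_hasCompactSupport hφ hs

theorem QC.IsWeakDzbar.locallyIntegrable {f h : ℂ → ℂ} (hh : QC.IsWeakDzbar f h) :
    LocallyIntegrable h := by
  obtain ⟨fx, fy, ⟨-, hx, -⟩, ⟨-, hy, -⟩, hae⟩ := hh
  have h1 : LocallyIntegrable fun z => (2 : ℂ)⁻¹ • (fx z + Complex.I • fy z) :=
    (hx.add (hy.smul Complex.I)).smul (2 : ℂ)⁻¹
  refine h1.congr ?_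
  filter_upwards [hae] with z hz
  rw [hz, smul_eq_mul, smul_eq_mul]
  ring

theorem QC.IsWeakDzbar.integral_mul_dbar {f h φ : ℂ → ℂ} (hh : QC.IsWeakDzbar f h)
    (hφ : ContDiff ℝ ∞ φ) (hs : HasCompactSupport φ) :
    ∫ w, f w * dbar φ w = -∫ w, h w * φ w := by
  obtain ⟨fx, fy, ⟨hf, hx, hx'⟩, ⟨-, hy, hy'⟩, hae⟩ := hh
  have hcd := hφ.continuous_fderiv (by simp)
  have hsd : ∀ v, HasCompactSupport fun w => fderiv ℝ φ w v := fun v =>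
    hs.fderiv_apply ℝ v
  have hi : ∀ v, Integrable fun w => f w * fderiv ℝ φ w v := fun v =>
    integrable_mul_of_hasCompactSupport hf (by fun_prop) (hsd v)
  have h1 : ∀ w, f w * dbar φ w = (1 / 2 : ℂ) * (f w * fderiv ℝ φ w 1) +
      (Complex.I / 2) * (f w * fderiv ℝ φ w Complex.I) := fun w => by
    simp only [dbar]; ring
  have h2 : ∫ w, h w * φ w = ∫ w, ((1 / 2 : ℂ) * (fx w * φ w) +
      (Complex.I / 2) * (fy w * φ w)) := by
    refine integral_congr_ae ?_
    filter_upwards [hae] with w hw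
    rw [hw]
    ring
  simp_rw [h1]
  rw [h2, integral_add ((hi 1).const_mul _) ((hi _).const_mul _),
    integral_add ((integrable_mul_of_hasCompactSupport hx hφ.continuous hs).const_mul _)
      ((integrable_mul_of_hasCompactSupport hy hφ.continuous hs).const_mul _),
    integral_const_mul, integral_const_mul, integral_const_mul, integral_const_mul,
    hx' φ hφ hs, hy' φ hφ hs]
  ring

/-- A smooth approximation `c² conj(x - w) / (c² |x - w|² + 1)` of the Cauchy kernel
`1 / (x - w)`. -/
noncomputable def smoothCauchy (c : ℝ) (x w : ℂ) : ℂ :=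
  (c : ℂ) ^ 2 * (starRingEnd ℂ) (x - w) *
    ((c : ℂ) ^ 2 * ((x - w) * (starRingEnd ℂ) (x - w)) + 1)⁻¹

theorem sq_mul_mul_conj_add_one (c : ℝ) (z : ℂ) :
    (c : ℂ) ^ 2 * (z * (starRingEnd ℂ) z) + 1 = ((1 + ‖c • z‖ ^ 2 : ℝ) : ℂ) := by
  rw [Complex.mul_conj, Complex.normSq_eq_norm_sq, norm_smul, mul_pow, Real.norm_eq_abs, sq_abs]
  push_cast
  ring

theorem sq_mul_mul_conj_add_one_ne_zero (c : ℝ) (z : ℂ) :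
    (c : ℂ) ^ 2 * (z * (starRingEnd ℂ) z) + 1 ≠ 0 := by
  rw [sq_mul_mul_conj_add_one, Complex.ofReal_ne_zero]
  positivity

theorem contDiff_smoothCauchy (c : ℝ) (x : ℂ) : ContDiff ℝ ∞ (smoothCauchy c x) := by
  have hconj : ContDiff ℝ ∞ fun w : ℂ => (starRingEnd ℂ) (x - w) :=
    Complex.conjCLE.contDiff.comp (contDiff_const.sub contDiff_id)
  refine (contDiff_const.mul hconj).mul (ContDiff.inv ?_
    fun w => sq_mul_mul_conj_add_one_ne_zero c (x - w))
  exact (contDiff_const.mul ((contDiff_const.sub contDiff_id).mul hconj)).add contDiff_const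

theorem dbar_const_sub (x w : ℂ) : dbar (fun w => x - w) w = 0 := by
  have h : HasFDerivAt (fun w : ℂ => x - w) (-(ContinuousLinearMap.id ℝ ℂ)) w :=
    (hasFDerivAt_id w).const_sub x
  simp only [dbar, h.fderiv, neg_apply, ContinuousLinearMap.id_apply, mul_neg, Complex.I_mul_I]
  ring

theorem hasFDerivAt_conj_sub (x w : ℂ) : HasFDerivAt (fun w : ℂ => (starRingEnd ℂ) (x - w))
    ((Complex.conjCLE : ℂ →L[ℝ] ℂ).comp (-(ContinuousLinearMap.id ℝ ℂ))) w :=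
  Complex.conjCLE.hasFDerivAt.comp w ((hasFDerivAt_id w).const_sub x)

theorem dbar_conj_sub (x w : ℂ) : dbar (fun w => (starRingEnd ℂ) (x - w)) w = -1 := by
  simp only [dbar, (hasFDerivAt_conj_sub x w).fderiv]
  simp

theorem dbar_const (a w : ℂ) : dbar (fun _ => a) w = 0 := by
  simp [dbar]

theorem dbar_add_const (φ : ℂ → ℂ) (a w : ℂ) : dbar (fun w => φ w + a) w = dbar φ w := by
  simp [dbar, fderiv_add_const]

/-- Up to sign and normalization the derivative is an approximate identity at `x`, which replaces
the statement that `1 / (πz)` is a fundamental solution of `∂̄`. -/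
theorem dbar_smoothCauchy (c : ℝ) (x w : ℂ) :
    dbar (smoothCauchy c x) w = -((c ^ 2 * ((1 + ‖c • (x - w)‖ ^ 2) ^ 2)⁻¹ : ℝ) : ℂ) := by
  have hsub : DifferentiableAt ℝ (fun w : ℂ => x - w) w := by fun_prop
  have hconj := (hasFDerivAt_conj_sub x w).differentiableAt
  have hN := sq_mul_mul_conj_add_one_ne_zero c (x - w)
  have hK := (contDiff_smoothCauchy c x).differentiable (by simp) w
  -- Differentiating the identity kernel times denominator equals numerator avoids a quotient rule
  -- for `dbar`.
  have hmul : ∀ w, smoothCauchy c x w *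
      ((c : ℂ) ^ 2 * ((x - w) * (starRingEnd ℂ) (x - w)) + 1) =
      (c : ℂ) ^ 2 * (starRingEnd ℂ) (x - w) := fun w => by
    rw [smoothCauchy, mul_assoc, inv_mul_cancel₀ (sq_mul_mul_conj_add_one_ne_zero c _), mul_one]
  have h := congrArg (fun f => dbar f w) (funext hmul)
  rw [dbar_mul hK (by fun_prop), dbar_add_const, dbar_mul (by fun_prop) (by fun_prop),
    dbar_mul hsub hconj, dbar_mul (by fun_prop) hconj, dbar_conj_sub, dbar_const_sub,
    dbar_const, smoothCauchy] at h
  have hN' := sq_mul_mul_conj_add_one c (x - w)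
  push_cast at hN' ⊢
  rw [← hN', ← div_eq_mul_inv, ← neg_div, eq_div_iff (pow_ne_zero 2 hN)]
  have hinv := inv_mul_cancel₀ hN
  set u := (starRingEnd ℂ) (x - w)
  set N := (c : ℂ) ^ 2 * ((x - w) * u) + 1 with hNdef
  linear_combination N * h + (c : ℂ) ^ 4 * u * (x - w) * hinv - (c : ℂ) ^ 2 * hNdef

theorem norm_smoothCauchy_le (c : ℝ) (x w : ℂ) : ‖smoothCauchy c x w‖ ≤ ‖(x - w)⁻¹‖ := by
  rcases eq_or_ne (x - w) 0 with h0 | h0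
  · simp [smoothCauchy, h0]
  have hz : 0 < ‖x - w‖ := norm_pos_iff.2 h0
  rw [smoothCauchy, sq_mul_mul_conj_add_one, norm_mul, norm_mul, norm_inv, norm_inv, norm_pow,
    Complex.norm_real, Complex.norm_real, RCLike.norm_conj, Real.norm_of_nonneg
      (by positivity : 0 ≤ 1 + ‖c • (x - w)‖ ^ 2), norm_smul, mul_pow, ← div_eq_mul_inv, ← one_div, div_le_div_iff₀ (by positivity) hz]
  nlinarith

theorem tendsto_smoothCauchy (x w : ℂ) :
    Filter.Tendsto (fun c => smoothCauchy c x w) Filter.atTop (nhds (x - w)⁻¹) := by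
  rcases eq_or_ne (x - w) 0 with h0 | h0
  · simp [smoothCauchy, h0]
  have hconj : (starRingEnd ℂ) (x - w) ≠ 0 := (map_ne_zero _).2 h0
  have hlim : Filter.Tendsto (fun c : ℝ => (starRingEnd ℂ) (x - w) *
      ((x - w) * (starRingEnd ℂ) (x - w) + (((c ^ 2)⁻¹ : ℝ) : ℂ))⁻¹) Filter.atTop
      (nhds ((starRingEnd ℂ) (x - w) *
        ((x - w) * (starRingEnd ℂ) (x - w) + ((0 : ℝ) : ℂ))⁻¹)) := by
    refine Filter.Tendsto.const_mul _ (Filter.Tendsto.inv₀ (Filter.Tendsto.const_add _ ?_) ?_)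
    · exact (Complex.continuous_ofReal.tendsto 0).comp
        (Filter.tendsto_pow_atTop two_ne_zero).inv_tendsto_atTop
    · rw [Complex.ofReal_zero, add_zero]
      exact mul_ne_zero h0 hconj
  have heq : (starRingEnd ℂ) (x - w) *
      ((x - w) * (starRingEnd ℂ) (x - w) + ((0 : ℝ) : ℂ))⁻¹ = (x - w)⁻¹ := by
    rw [Complex.ofReal_zero, add_zero]
    field_simp
  rw [heq] at hlim
  refine hlim.congr' ?_
  filter_upwards [Filter.eventually_gt_atTop 0] with c hc
  have hc0 : (c : ℂ) ≠ 0 := Complex.ofReal_ne_zero.2 hc.ne'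
  have hN := sq_mul_mul_conj_add_one_ne_zero c (x - w)
  have h1 : (x - w) * (starRingEnd ℂ) (x - w) + (((c ^ 2)⁻¹ : ℝ) : ℂ) =
      ((c : ℂ) ^ 2)⁻¹ * ((c : ℂ) ^ 2 * ((x - w) * (starRingEnd ℂ) (x - w)) + 1) := by
    push_cast
    field_simp
  rw [h1, smoothCauchy, mul_inv, inv_inv]
  ring

theorem integrable_inv_one_add_norm_sq_sq :
    Integrable fun z : ℂ => ((1 + ‖z‖ ^ 2) ^ 2)⁻¹ := by
  have h := integrable_rpow_neg_one_add_norm_sq (E := ℂ) (μ := volume) (r := 4)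
    (by rw [Complex.finrank_real_complex]; norm_num)
  refine h.congr (Filter.Eventually.of_forall fun z => ?_)
  simp only
  rw [show (-4 / 2 : ℝ) = -(2 : ℕ) by norm_num, Real.rpow_neg (by positivity),
    Real.rpow_natCast]

/-- The value is `π`, but only its being nonzero is needed, to divide in the Cauchy–Pompeiu formula.
-/
theorem integral_inv_one_add_norm_sq_sq_pos : 0 < ∫ z : ℂ, ((1 + ‖z‖ ^ 2) ^ 2)⁻¹ := by
  rw [integral_pos_iff_support_of_nonneg (fun z => by positivity)
    integrable_inv_one_add_norm_sq_sq]
  have : Function.support (fun z : ℂ => ((1 + ‖z‖ ^ 2) ^ 2)⁻¹) = Set.univ := by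
    ext z
    simp only [Function.mem_support, Set.mem_univ, iff_true]
    positivity
  simp [this]

theorem tendsto_integral_dbar_smoothCauchy {g : ℂ → ℂ} (hg : Integrable g) {x : ℂ}
    (hx : ContinuousAt g x) :
    Filter.Tendsto (fun c : ℝ => ∫ w, g w * -dbar (smoothCauchy c x) w) Filter.atTop
      (nhds (((∫ z : ℂ, ((1 + ‖z‖ ^ 2) ^ 2)⁻¹ : ℝ) : ℂ) * g x)) := by
  set κ := ∫ z : ℂ, ((1 + ‖z‖ ^ 2) ^ 2)⁻¹ with hκ
  have hκ0 : 0 < κ := integral_inv_one_add_norm_sq_sq_pos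
  -- The decay required of a peak function: `o(|z|⁻²)` at infinity, the dimension being `2`.
  have hcob : Filter.Tendsto (fun z : ℂ => ‖z‖ ^ Module.finrank ℝ ℂ *
      (κ⁻¹ * ((1 + ‖z‖ ^ 2) ^ 2)⁻¹)) (Bornology.cobounded ℂ) (nhds 0) := by
    have h1 : Filter.Tendsto (fun z : ℂ => κ⁻¹ * (‖z‖ ^ 2)⁻¹) (Bornology.cobounded ℂ)
        (nhds (κ⁻¹ * 0)) :=
      (((Filter.tendsto_pow_atTop two_ne_zero).comp
        tendsto_norm_cobounded_atTop).inv_tendsto_atTop).const_mul _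
    rw [mul_zero] at h1
    refine squeeze_zero (fun z => by positivity) (fun z => ?_) h1
    rw [Complex.finrank_real_complex, mul_left_comm]
    gcongr
    rcases eq_or_ne z 0 with rfl | hz
    · simp
    have : 0 < ‖z‖ := norm_pos_iff.2 hz
    rw [← div_eq_mul_inv, div_le_iff₀ (by positivity), inv_mul_eq_div, le_div_iff₀ (by positivity)]
    nlinarith [sq_nonneg (‖z‖ ^ 2)]
  have h := tendsto_integral_comp_smul_smul_of_integrable' (μ := volume)
    (φ := fun z : ℂ => κ⁻¹ * ((1 + ‖z‖ ^ 2) ^ 2)⁻¹) (fun z => by positivity)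
    (by rw [integral_const_mul, ← hκ, inv_mul_cancel₀ hκ0.ne']) hcob hg hx
  refine (h.const_mul (κ : ℂ)).congr fun c => ?_
  rw [← integral_const_mul]
  refine integral_congr_ae (Filter.Eventually.of_forall fun w => ?_)
  simp only
  rw [dbar_smoothCauchy, neg_neg, Complex.finrank_real_complex, Complex.real_smul]
  have : (κ : ℂ) ≠ 0 := Complex.ofReal_ne_zero.2 hκ0.ne'
  push_cast
  field_simp

/-- The Cauchy–Pompeiu formula for a continuous function with weak `∂̄`-derivative `h`, localized
by a cutoff function `χ`, at a point where the Cauchy integral converges absolutely. -/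
theorem QC.IsWeakDzbar.cauchy_pompeiu {f h χ : ℂ → ℂ} (hf : Continuous f)
    (hh : QC.IsWeakDzbar f h) (hχ : ContDiff ℝ ∞ χ) (hs : HasCompactSupport χ) {x : ℂ}
    (hi : Integrable fun w => (h w * χ w + f w * dbar χ w) * (x - w)⁻¹) :
    ((∫ z : ℂ, ((1 + ‖z‖ ^ 2) ^ 2)⁻¹ : ℝ) : ℂ) * (f x * χ x) =
      ∫ w, (h w * χ w + f w * dbar χ w) * (x - w)⁻¹ := by
  have hfχ : Continuous fun w => f w * χ w := hf.mul hχ.continuous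
  have hfl : LocallyIntegrable f := hf.locallyIntegrable
  have hleft := tendsto_integral_dbar_smoothCauchy
    (hfχ.integrable_of_hasCompactSupport hs.mul_left) (x := x) hfχ.continuousAt
  have hAm : AEStronglyMeasurable fun w => h w * χ w + f w * dbar χ w :=
    (hh.locallyIntegrable.aestronglyMeasurable.mul hχ.continuous.aestronglyMeasurable).add
      (hf.mul (continuous_dbar hχ)).aestronglyMeasurable
  have hright : Filter.Tendsto
      (fun c => ∫ w, (h w * χ w + f w * dbar χ w) * smoothCauchy c x w) Filter.atTop
      (nhds (∫ w, (h w * χ w + f w * dbar χ w) * (x - w)⁻¹)) := by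
    refine tendsto_integral_filter_of_dominated_convergence _ ?_ ?_ hi.norm ?_
    · exact Filter.Eventually.of_forall fun c =>
        hAm.mul (contDiff_smoothCauchy c x).continuous.aestronglyMeasurable
    · refine Filter.Eventually.of_forall fun c => Filter.Eventually.of_forall fun w => ?_
      rw [norm_mul, norm_mul]
      gcongr
      exact norm_smoothCauchy_le c x w
    · exact Filter.Eventually.of_forall fun w => (tendsto_smoothCauchy x w).const_mul _
  -- Both limits are limits of one family in `c`: the weak derivative tested against `smoothCauchy c
  -- x * χ` identifies the two integrals.
  refine tendsto_nhds_unique hleft (hright.congr fun c => ?_)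
  have hK := contDiff_smoothCauchy c x
  have hweak := hh.integral_mul_dbar (hK.mul hχ) hs.mul_left
  have hdbar : ∀ w, f w * dbar (fun w => smoothCauchy c x w * χ w) w =
      f w * (smoothCauchy c x w * dbar χ w) - f w * χ w * -dbar (smoothCauchy c x) w := by
    intro w
    rw [dbar_mul (hK.differentiable (by simp) w) (hχ.differentiable (by simp) w)]
    ring
  simp_rw [hdbar] at hweak
  have hi1 : Integrable fun w => f w * (smoothCauchy c x w * dbar χ w) :=
    integrable_mul_of_hasCompactSupport hfl (hK.continuous.mul (continuous_dbar hχ))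
      (hasCompactSupport_dbar hs).mul_left
  have hi2 : Integrable fun w => f w * χ w * -dbar (smoothCauchy c x) w :=
    (hfχ.mul (continuous_dbar hK).neg).integrable_of_hasCompactSupport hs.mul_left.mul_right
  have hi3 : Integrable fun w => h w * (smoothCauchy c x w * χ w) :=
    integrable_mul_of_hasCompactSupport hh.locallyIntegrable (hK.continuous.mul hχ.continuous)
      hs.mul_left
  rw [integral_sub hi1 hi2] at hweak
  have hsplit : ∫ w, (h w * χ w + f w * dbar χ w) * smoothCauchy c x w =
      (∫ w, h w * (smoothCauchy c x w * χ w)) +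
        ∫ w, f w * (smoothCauchy c x w * dbar χ w) := by
    rw [← integral_add hi3 hi1]
    congr 1 with w
    ring
  rw [hsplit]
  linear_combination hweak

/-! ### Localization and conclusion -/

/-- The cutoff equals `1` up to radius `R + 1`, so that the support of its `dbar` keeps distance at
least `1` from `[-R, R]`. -/
theorem exists_smooth_cutoff {R : ℝ} (hR : 0 < R) :
    ∃ χ : ℂ → ℂ, ContDiff ℝ ∞ χ ∧ HasCompactSupport χ ∧ (∀ w, ‖w‖ ≤ R → χ w = 1) ∧
      (∀ w, χ w ≠ 0 → ‖w‖ ≤ R + 2) ∧ (∀ w, ‖χ w‖ ≤ 1) ∧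
      ∀ w, dbar χ w ≠ 0 → R + 1 ≤ ‖w‖ := by
  let b : ContDiffBump (0 : ℂ) := ⟨R + 1, R + 2, by linarith, by linarith⟩
  have hone : ∀ w : ℂ, ‖w‖ ≤ R + 1 → (b w : ℂ) = 1 := fun w hw => by
    rw [b.one_of_mem_closedBall (by simpa using hw), Complex.ofReal_one]
  refine ⟨fun w => (b w : ℂ), Complex.ofRealCLM.contDiff.comp b.contDiff,
    b.hasCompactSupport.comp_left Complex.ofReal_zero, fun w hw => hone w (by linarith),
    fun w hw => ?_, fun w => ?_, fun w hw => ?_⟩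
  · have hmem : w ∈ Function.support b := Complex.ofReal_ne_zero.1 hw
    rw [b.support_eq, Metric.mem_ball, dist_zero_right] at hmem
    exact hmem.le
  · rw [Complex.norm_real, Real.norm_of_nonneg b.nonneg]
    exact b.le_one
  · by_contra! hlt
    have hev : (fun w => (b w : ℂ)) =ᶠ[nhds w] fun _ => 1 := by
      filter_upwards [continuous_norm.continuousAt.eventually_lt_const hlt] with z hz
      exact hone z hz.le
    refine hw ?_
    simp [dbar, hev.fderiv_eq]

theorem QC.IsWeakDzbar.congr_ae {f h h' : ℂ → ℂ} (hh : QC.IsWeakDzbar f h)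
    (hae : ∀ᵐ z, h' z = h z) : QC.IsWeakDzbar f h' := by
  obtain ⟨fx, fy, hx, hy, heq⟩ := hh
  refine ⟨fx, fy, hx, hy, ?_⟩
  filter_upwards [heq, hae] with z h1 h2
  rw [h2, h1]

theorem QC.IsWeakDzbar.exists_measurable {f h : ℂ → ℂ} (hh : QC.IsWeakDzbar f h) :
    ∃ h' : ℂ → ℂ, Measurable h' ∧ (∀ᵐ z, h' z = h z) ∧ QC.IsWeakDzbar f h' := by
  have hm := hh.locallyIntegrable.aestronglyMeasurable
  have hae : ∀ᵐ z, hm.mk h z = h z := hm.ae_eq_mk.symm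
  exact ⟨hm.mk h, hm.stronglyMeasurable_mk.measurable, hae, hh.congr_ae hae⟩

theorem ae_im_ne_zero_of_weighted {h : ℂ → ℂ} (hm : Measurable h)
    (hfin : ∫⁻ w, ‖h w‖ₑ ^ 2 / ENNReal.ofReal |w.im| < ⊤) : ∀ᵐ w, h w ≠ 0 → w.im ≠ 0 := by
  have hmeas : Measurable fun w => ‖h w‖ₑ ^ 2 / ENNReal.ofReal |w.im| :=
    (hm.enorm.pow_const 2).div Complex.measurable_im.abs.ennreal_ofReal
  filter_upwards [ae_lt_top hmeas hfin.ne] with w hw h0 him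
  -- In `ENNReal`, `a / 0 = ⊤` for `a ≠ 0`, so the weighted integrand is infinite wherever `h` is
  -- nonzero on the real axis.
  rw [him, abs_zero, ENNReal.ofReal_zero, ENNReal.div_zero (by simpa using h0)] at hw
  exact hw.ne rfl

theorem QC.IsWeakDzbar.exists_isL2PrimitiveLimit {f h : ℂ → ℂ} (hf : Continuous f)
    (hh : QC.IsWeakDzbar f h) (hm : Measurable h)
    (hfin : ∫⁻ w, ‖h w‖ₑ ^ 2 / ENNReal.ofReal |w.im| < ⊤) {R : ℝ} (hR : 0 < R) :
    ∃ F T M, IsL2PrimitiveLimit (fun x : ℝ => f x) (-R) R F T M := by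
  obtain ⟨χ, hχ, hs, hχ1, hχR, hχle, hχd⟩ := exists_smooth_cutoff hR
  have hχm := hχ.continuous.measurable
  set A : ℂ → ℂ := fun w => h w * χ w with hA
  set B : ℂ → ℂ := fun w => f w * dbar χ w
  have hAm : Measurable A := hm.mul hχm
  have hAi : Integrable A := integrable_mul_of_hasCompactSupport hh.locallyIntegrable
    hχ.continuous hs
  have hBc : Continuous B := hf.mul (continuous_dbar hχ)
  have hBi : Integrable B := hBc.integrable_of_hasCompactSupport
    (hasCompactSupport_dbar hs).mul_left
  have hAL : ∀ w, A w ≠ 0 → |w.im| ≤ R + 2 := fun w hw =>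
    (Complex.abs_im_le_norm w).trans (hχR w (right_ne_zero_of_mul hw))
  have hsep : ∀ x ∈ Set.Icc (-R) R, ∀ w, B w ≠ 0 → 1 ≤ ‖(x : ℂ) - w‖ := fun x hx w hw => by
    have h1 := hχd w (right_ne_zero_of_mul hw)
    have h2 := norm_sub_norm_le w x
    rw [Complex.norm_real, Real.norm_eq_abs, norm_sub_rev] at h2
    linarith [abs_le.2 hx]
  have hAfin : ∀ S : Set ℂ,
      ∫⁻ w, ‖S.indicator A w‖ₑ ^ 2 / ENNReal.ofReal |w.im| < ⊤ := fun S => by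
    refine lt_of_le_of_lt (lintegral_mono fun w => ?_) hfin
    gcongr
    refine enorm_le_iff_norm_le.2 ((norm_indicator_le_norm_self _ _).trans ?_)
    rw [hA, norm_mul]
    exact mul_le_of_le_one_right (norm_nonneg _) (hχle w)
  have hSU : MeasurableSet {w : ℂ | 0 < w.im} :=
    measurableSet_lt measurable_const Complex.measurable_im
  have hSL : MeasurableSet {w : ℂ | w.im < 0} :=
    measurableSet_lt Complex.measurable_im measurable_const
  -- The square function estimate needs all of the density in one half plane, so the singular part
  -- is split by the sign of `Im w`.
  set U := {w : ℂ | 0 < w.im}.indicator A with hU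
  set V := {w : ℂ | w.im < 0}.indicator A with hV
  have hUmem : ∀ w, U w ≠ 0 → 0 < w.im ∧ A w ≠ 0 := fun w hw => by simpa [hU] using hw
  have hVmem : ∀ w, V w ≠ 0 → w.im < 0 ∧ A w ≠ 0 := fun w hw => by simpa [hV] using hw
  obtain ⟨F₁, T₁, M₁, h₁⟩ := isL2PrimitiveLimit_cauchyInt_of_weighted (hAm.indicator hSU)
    (hAi.indicator hSU) (fun w w' hw hw' => mul_pos (hUmem w hw).1 (hUmem w' hw').1)
    (fun w hw => hAL w (hUmem w hw).2) (hAfin _) (-R) R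
  obtain ⟨F₂, T₂, M₂, h₂⟩ := isL2PrimitiveLimit_cauchyInt_of_weighted (hAm.indicator hSL)
    (hAi.indicator hSL) (fun w w' hw hw' => mul_pos_of_neg_of_neg (hVmem w hw).1 (hVmem w' hw').1)
    (fun w hw => hAL w (hVmem w hw).2) (hAfin _) (-R) R
  have h₃ := isL2PrimitiveLimit_cauchyInt_of_separated hBc.measurable hBi one_pos hsep
  set κ : ℝ := ∫ z : ℂ, ((1 + ‖z‖ ^ 2) ^ 2)⁻¹
  have hκ : (κ : ℂ) ≠ 0 := Complex.ofReal_ne_zero.2 integral_inv_one_add_norm_sq_sq_pos.ne'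
  refine ⟨_, _, _, (((h₁.add h₂).add h₃).const_mul (κ : ℂ)⁻¹).congr fun x hx => ?_⟩
  have hi₁ : Integrable fun w => U w * ((x : ℂ) - w)⁻¹ :=
    integrable_mul_inv_of_weighted (hAm.indicator hSU) (fun w hw => (hUmem w hw).1.ne')
      (fun w hw => hAL w (hUmem w hw).2) (hAfin _) x
  have hi₂ : Integrable fun w => V w * ((x : ℂ) - w)⁻¹ :=
    integrable_mul_inv_of_weighted (hAm.indicator hSL) (fun w hw => (hVmem w hw).1.ne)
      (fun w hw => hAL w (hVmem w hw).2) (hAfin _) x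
  have hi₃ : Integrable fun w => B w * ((x : ℂ) - w)⁻¹ :=
    integrable_mul_inv hBc.measurable hBi one_pos (hsep x hx)
  have hi₁₂ : Integrable fun w => U w * ((x : ℂ) - w)⁻¹ + V w * ((x : ℂ) - w)⁻¹ := hi₁.add hi₂
  have hae : (fun w => U w * ((x : ℂ) - w)⁻¹ + V w * ((x : ℂ) - w)⁻¹ + B w * ((x : ℂ) - w)⁻¹)
      =ᵐ[volume] fun w => (h w * χ w + f w * dbar χ w) * ((x : ℂ) - w)⁻¹ := by
    filter_upwards [ae_im_ne_zero_of_weighted hm hfin] with w hw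
    rw [← add_mul, ← add_mul]
    congr 2
    -- On the axis itself both indicators vanish; there `h w = 0` for almost every `w`, by
    -- finiteness of the weighted integral.
    rcases lt_trichotomy w.im 0 with him | him | him
    · simp [hU, hV, hA, him, him.not_gt]
    · simp [hU, hV, him, not_not.1 (mt hw (not_not.2 him))]
    · simp [hU, hV, hA, him, him.not_gt]
  have hCP := hh.cauchy_pompeiu hf hχ hs (x := x) ((hi₁₂.add hi₃).congr hae)
  rw [hχ1 x (by rw [Complex.norm_real, Real.norm_eq_abs]; exact abs_le.2 hx), mul_one,
    ← integral_congr_ae hae, integral_add hi₁₂ hi₃, integral_add hi₁ hi₂] at hCP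
  rw [eq_inv_mul_iff_mul_eq₀ hκ]
  exact hCP

theorem theorem3 (ρ : ℂ → ℂ) (hρ : QC.IsQuasiconformal ρ) (hinf : QC.AnalyticAtInfty ρ)
    (dbarρ : ℂ → ℂ) (hdbar : QC.IsWeakDzbar ρ dbarρ)
    (hint : ∫⁻ z : ℂ, ‖dbarρ z‖ₑ ^ 2 / ENNReal.ofReal |z.im| < ⊤) :
    QC.IsLocallyRectifiable (fun x : ℝ => ρ x) ∧
    (∀ a b : ℝ, AbsolutelyContinuousOnInterval (fun x : ℝ => ρ x) a b) ∧
    (∀ᵐ x : ℝ, DifferentiableAt ℝ (fun x : ℝ => ρ x) x) ∧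
    QC.MemL2Loc (deriv (fun x : ℝ => ρ x)) := by
  have hcont : Continuous ρ := hρ.isHomeomorph.continuous
  obtain ⟨h, hm, hae, hh⟩ := hdbar.exists_measurable
  have hfin : ∫⁻ w, ‖h w‖ₑ ^ 2 / ENNReal.ofReal |w.im| < ⊤ := by
    refine lt_of_eq_of_lt (lintegral_congr_ae ?_) hint
    filter_upwards [hae] with w hw
    rw [hw]
  exact regularity_of_isL2PrimitiveLimit (hcont.comp Complex.continuous_ofReal)
    fun R hR => hh.exists_isL2PrimitiveLimit hcont hm hfin hR
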